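/- **Dual numbers and orders.** Let $\mathcal R^{(2)}=\mathbb R\oplus\mathbb R\,1^{\#}$ with $1^{\#}1^{\#}=0$ be the dual real numbers, and write $x=\mathrm{Re}\,x+(\mathrm{Ze}\,x)1^{\#}$. For $\theta\in\{1,2\}$ write $x\le_\theta y$ if $\mathrm{Re}\,x\le\mathrm{Re}\,y$ and $(-1)^{\theta-1}\mathrm{Ze}\,x\le(-1)^{\theta-1}\mathrm{Ze}\,y$, write $x<_\theta y$ if moreover $x\neq y$, and let $[a,b]_\theta=\{x: a\le_\theta x\le_\theta b\}$. **Type $\theta$ integral.** A partition of $[a^1,b^1]_\theta\times\cdots\times[a^k,b^k]_\theta$ (where $a^i<_\theta b^i$) consists of a finite chain $a^i=x^{i(0)}<_\theta\cdots<_\theta x^{i(N_i)}=b^i$ for each $i$. Its subrectangles are $S=\prod_i[x^{i(j_i-1)},x^{i(j_i)}]_\theta$, with $v(S)=\prod_i(x^{i(j_i)}-x^{i(j_i-1)})\in\mathcal R^{(2)}$. For a bounded function $f=f_{Re}+f_{Ze}1^{\#}$ put $U_1(P,f)=\sum_S(\sup_S f_{Re}+1^{\#}\sup_S f_{Ze})v(S)$,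 $L_1(P,f)=\sum_S(\inf_S f_{Re}+1^{\#}\inf_S f_{Ze})v(S)$, $U_2(P,f)=\sum_S(\sup_S f_{Re}+1^{\#}\inf_S f_{Ze})v(S)$, $L_2(P,f)=\sum_S(\inf_S f_{Re}+1^{\#}\sup_S f_{Ze})v(S)$. The upper integral is $\inf_P\mathrm{Re}\,U_1+1^{\#}\inf_P\mathrm{Ze}\,U_1$ for $\theta=1$ and $\inf_P\mathrm{Re}\,U_2+1^{\#}\sup_P\mathrm{Ze}\,U_2$ for $\theta=2$. The lower integral is $\sup_P\mathrm{Re}\,L_1+1^{\#}\sup_P\mathrm{Ze}\,L_1$ for $\theta=1$ and $\sup_P\mathrm{Re}\,L_2+1^{\#}\inf_P\mathrm{Ze}\,L_2$ for $\theta=2$. The function $f$ is type $\theta$ integrable if it is bounded and these agree; the common value is its type $\theta$ integral. **Differentiation and forms.** Put $\|x\|^2=\sum_i\big(2(\mathrm{Re}\,x^i)^2+(\mathrm{Ze}\,x^i)^2\big)$ on $(\mathcal R^{(2)})^n$. A map $f$ from an open subset of $(\mathcal R^{(2)})^n$ to $(\mathcal R^{(2)})^m$ is dual real differentiable at $a$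 if there is an $\mathcal R^{(2)}$-linear map $\mathcal Df(a)$ with $\|f(x)-f(a)-\mathcal Df(a)(x-a)\|/\|x-a\|\to0$ as $x\to a$. A dual real differentiable $k$-form on an open set $A$ is $w=\sum_{i_1<\dots<i_k}w_{i_1\dots i_k}\,dx^{i_1}\wedge\cdots\wedge dx^{i_k}$ with dual real differentiable coefficients on $A$, where $w(p)$ is an alternating $\mathcal R^{(2)}$-multilinear $k$-tensor. Put $dw=\sum dw_{i_1\dots i_k}\wedge dx^{i_1}\wedge\cdots\wedge dx^{i_k}$, where $df(p)=\mathcal Df(p)$. The pullback $g^*w$ is defined by $(g^*w)(p)(v_1,\dots,v_k)=w(g(p))(\mathcal Dg(p)v_1,\dots,\mathcal Dg(p)v_k)$. **Cubes and chains.** Fix $r\ge0$ and $b=1+(-1)^{\theta-1}r\,1^{\#}$. A type $\theta$ singular $k$-cube in $A$ is a function $c:[0,b]_\theta^k\to A$ that extends to a dual real differentiable function $g$ on an open set containing $[0,b]_\theta^k$, such that $\mathcal Dg$ is dual real differentiable as well (that is, $p\mapsto\mathcal Dg(p)(v)$ is dual real differentiable for each $v$). A $0$-cube is a point of $A$. A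 type $\theta$ $k$-chain in $A$ is a finite formal sum of such cubes with integer coefficients. The boundary is the additive extension of $\partial c=\sum_{j=1}^k\sum_{\alpha=0,1}(-1)^{j+\alpha}c_{(j,\alpha)}$, where $c_{(j,\alpha)}(x^1,\dots,x^{k-1})=c(x^1,\dots,x^{j-1},\alpha b,x^j,\dots,x^{k-1})$. For $k\ge1$, $\int_c w$ is the type $\theta$ integral over $[0,b]_\theta^k$ of the function $f$ with $c^*w=f\,dx^1\wedge\cdots\wedge dx^k$, where $\mathcal Dc$ means the derivative of an extension (which is determined by $c$ on $[0,b]^k_\theta$). For $k=0$, $\int_c w=w(c(0))$. For chains, $\int_{\sum a_ic_i}w=\sum a_i\int_{c_i}w$. **Theorem (type $\theta$ Stokes' theorem).** Let $k\ge1$, let $A\subseteq(\mathcal R^{(2)})^n$ be open, and let $w$ be a dual real differentiable $(k-1)$-form on $A$ whose differential $dw$ is a dual real differentiable $k$-form on $A$. Let $c$ be a type $\theta$ $k$-chain in $A$. Then the integrals of $dw$ over the cubes of $c$ and of $w$ over the cubes of $\partial c$ all exist, and $$\int_c dw=\int_{\partial c}w.$$ -/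

import Mathlib

open Filter Topology
open scoped Nat NNReal DualNumber

noncomputable section

namespace DualStokes

/-! ### Dual real numbers, the two orders, dual real space -/

/-- The dual real numbers `ℝ ⊕ ℝ 1^#` with `1^# * 1^# = 0`, with their usual (product) topology. -/
abbrev Dual : Type := DualNumber ℝ

/-- The dual real `n`-space, a module over the dual real numbers. -/
abbrev Space (n : ℕ) : Type := Fin n → Dual

/-- The real part. -/
def Re (x : Dual) : ℝ := TrivSqZeroExt.fst x

/-- The zero-divisor part. -/
def Ze (x : Dual) : ℝ := TrivSqZeroExt.snd x

/-- The dual number `a + c 1^#`. -/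
def mkDual (a c : ℝ) : Dual := TrivSqZeroExt.inl a + TrivSqZeroExt.inr c

/-- The letter `θ`, which takes the two values 1 and 2. -/
inductive Kind
  | one
  | two

/-- `(-1)^(θ-1)`. -/
def Kind.sgn : Kind → ℝ
  | .one => 1
  | .two => -1

/-- `x` is type `θ` less than `y`. -/
def TLt : Kind → Dual → Dual → Prop
  | .one, x, y => (Re x < Re y ∧ Ze x ≤ Ze y) ∨ (Re x = Re y ∧ Ze x < Ze y)
  | .two, x, y => (Re x < Re y ∧ Ze y ≤ Ze x) ∨ (Re x = Re y ∧ Ze y < Ze x)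

/-- `x` is type `θ` less than or equal to `y`. -/
def TLe (θ : Kind) (x y : Dual) : Prop := TLt θ x y ∨ x = y

/-- The type `θ` closed interval. -/
def TIcc (θ : Kind) (a b : Dual) : Set Dual := {x | TLe θ a x ∧ TLe θ x b}

/-- The norm `(2 ∑ (x^{i1})² + ∑ (x^{i2})²)^{1/2}`.  It induces the product topology. -/
def dnorm {n : ℕ} (x : Space n) : ℝ :=
  Real.sqrt (2 * ∑ i, Re (x i) ^ 2 + ∑ i, Ze (x i) ^ 2)

/-! ### Dual real differentiation -/

/-- `f` is dual real differentiable at `a`, with dual real derivative the module map `L`. -/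
def HasDualDeriv {n m : ℕ} (f : Space n → Space m) (L : Space n →ₗ[Dual] Space m)
    (a : Space n) : Prop :=
  Tendsto (fun x => dnorm (f x - f a - L (x - a)) / dnorm (x - a)) (𝓝[≠] a) (𝓝 0)

/-- `f` is dual real differentiable on (the open set) `U`. -/
def DualDiffOn {n m : ℕ} (f : Space n → Space m) (U : Set (Space n)) : Prop :=
  ∀ a ∈ U, ∃ L : Space n →ₗ[Dual] Space m, HasDualDeriv f L a

open Classical in
/-- The dual real derivative `𝓓 f (a)` (zero where `f` is not dual real differentiable). -/
def dualDeriv {n m : ℕ} (f : Space n → Space m) (a : Space n) : Space n →ₗ[Dual] Space m :=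
  if h : ∃ L : Space n →ₗ[Dual] Space m, HasDualDeriv f L a then h.choose else 0

/-- A dual-valued function, seen as a function into dual real `1`-space. -/
def toSpaceOne {n : ℕ} (f : Space n → Dual) : Space n → Space 1 := fun x _ => f x

/-- `f` is dual real differentiable on the open set `U`, and so is its dual real derivative
(that is, all the functions `a ↦ 𝓓 f (a) (v)`). -/
def TwiceDualDiffOn {n m : ℕ} (f : Space n → Space m) (U : Set (Space n)) : Prop :=
  ∃ L : Space n → (Space n →ₗ[Dual] Space m),
    (∀ a ∈ U, HasDualDeriv f (L a) a) ∧ ∀ v, DualDiffOn (fun a => L a v) U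

/-! ### Type `θ` integration -/

/-- A partition `a = x⁽⁰⁾ < x⁽¹⁾ < ⋯ < x⁽ᴺ⁾ = b` of a type `θ` interval, for the type `θ` order. -/
structure TPartition (θ : Kind) (a b : Dual) where
  N : ℕ
  pt : Fin (N + 1) → Dual
  pt_zero : pt 0 = a
  pt_last : pt (Fin.last N) = b
  lt : ∀ i : Fin N, TLt θ (pt i.castSucc) (pt i.succ)

/-- The type `θ` closed rectangle `∏ [a i, b i]_θ`. -/
def TRect (θ : Kind) {n : ℕ} (a b : Space n) : Set (Space n) := {x | ∀ i, x i ∈ TIcc θ (a i) (b i)}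

/-- A partition of a type `θ` closed rectangle. -/
abbrev RectPartition (θ : Kind) {n : ℕ} (a b : Space n) : Type :=
  (i : Fin n) → TPartition θ (a i) (b i)

section sums

variable {θ : Kind} {n : ℕ} {a b : Space n}

/-- The indices of the subrectangles of a partition. -/
abbrev RectPartition.Index (P : RectPartition θ a b) : Type := (i : Fin n) → Fin (P i).N

/-- The subrectangles of a partition. -/
def RectPartition.sub (P : RectPartition θ a b) (j : RectPartition.Index P) : Set (Space n) :=
  TRect θ (fun i => (P i).pt (j i).castSucc) (fun i => (P i).pt (j i).succ)

/-- The dual real volume of a subrectangle. -/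
def RectPartition.vol (P : RectPartition θ a b) (j : RectPartition.Index P) : Dual :=
  ∏ i, ((P i).pt (j i).succ - (P i).pt (j i).castSucc)

end sums

/-- The supremum of `g` on `S`. -/
def supOn {n : ℕ} (g : Space n → ℝ) (S : Set (Space n)) : ℝ := sSup (g '' S)

/-- The infimum of `g` on `S`. -/
def infOn {n : ℕ} (g : Space n → ℝ) (S : Set (Space n)) : ℝ := sInf (g '' S)

/-- The type `θ` upper sum. -/
def upperSum {n : ℕ} (f : Space n → Dual) {a b : Space n} :
    (θ : Kind) → RectPartition θ a b → Dual
  | .one, P => ∑ j : RectPartition.Index P,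
      mkDual (supOn (fun x => Re (f x)) (RectPartition.sub P j))
        (supOn (fun x => Ze (f x)) (RectPartition.sub P j)) * RectPartition.vol P j
  | .two, P => ∑ j : RectPartition.Index P,
      mkDual (supOn (fun x => Re (f x)) (RectPartition.sub P j))
        (infOn (fun x => Ze (f x)) (RectPartition.sub P j)) * RectPartition.vol P j

/-- The type `θ` lower sum. -/
def lowerSum {n : ℕ} (f : Space n → Dual) {a b : Space n} :
    (θ : Kind) → RectPartition θ a b → Dual
  | .one, P => ∑ j : RectPartition.Index P,
      mkDual (infOn (fun x => Re (f x)) (RectPartition.sub P j))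
        (infOn (fun x => Ze (f x)) (RectPartition.sub P j)) * RectPartition.vol P j
  | .two, P => ∑ j : RectPartition.Index P,
      mkDual (infOn (fun x => Re (f x)) (RectPartition.sub P j))
        (supOn (fun x => Ze (f x)) (RectPartition.sub P j)) * RectPartition.vol P j

/-- The type `θ` lower integral of `f` on the rectangle `∏ [a i, b i]_θ`. -/
def lowerIntegral {n : ℕ} (f : Space n → Dual) (a b : Space n) : Kind → Dual
  | .one => mkDual (⨆ P : RectPartition .one a b, Re (lowerSum f .one P))
      (⨆ P : RectPartition .one a b, Ze (lowerSum f .one P))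
  | .two => mkDual (⨆ P : RectPartition .two a b, Re (lowerSum f .two P))
      (⨅ P : RectPartition .two a b, Ze (lowerSum f .two P))

/-- The type `θ` upper integral of `f` on the rectangle `∏ [a i, b i]_θ`. -/
def upperIntegral {n : ℕ} (f : Space n → Dual) (a b : Space n) : Kind → Dual
  | .one => mkDual (⨅ P : RectPartition .one a b, Re (upperSum f .one P))
      (⨅ P : RectPartition .one a b, Ze (upperSum f .one P))
  | .two => mkDual (⨅ P : RectPartition .two a b, Re (upperSum f .two P))
      (⨆ P : RectPartition .two a b, Ze (upperSum f .two P))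

/-- `f` is bounded on `S`: its real part and its zero-divisor part are. -/
def DualBoundedOn {n : ℕ} (f : Space n → Dual) (S : Set (Space n)) : Prop :=
  ∃ m M : ℝ, ∀ x ∈ S, (m ≤ Re (f x) ∧ Re (f x) ≤ M) ∧ (m ≤ Ze (f x) ∧ Ze (f x) ≤ M)

/-- `f` is type `θ` integrable on `∏ [a i, b i]_θ`: it is bounded there, and its lower and upper
integrals are equal. -/
def TIntegrable (θ : Kind) {n : ℕ} (f : Space n → Dual) (a b : Space n) : Prop :=
  DualBoundedOn f (TRect θ a b) ∧ lowerIntegral f a b θ = upperIntegral f a b θ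

/-- The type `θ` integral (the common value of the lower and the upper integral when `f` is
type `θ` integrable). -/
def tIntegral (θ : Kind) {n : ℕ} (f : Space n → Dual) (a b : Space n) : Dual :=
  upperIntegral f a b θ

/-! ### Alternating tensors and differential forms -/

/-- Alternating dual real `k`-tensors on dual real `n`-space. -/
abbrev Alt (n k : ℕ) : Type := Space n [⋀^Fin k]→ₗ[Dual] Dual

/-- The tensor product `(S ⊗ T)(v₁, …, v_{k+l}) = S(v₁, …, v_k) T(v_{k+1}, …, v_{k+l})`. -/
def tensor {n k l : ℕ} (S : MultilinearMap Dual (fun _ : Fin k => Space n) Dual)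
    (T : MultilinearMap Dual (fun _ : Fin l => Space n) Dual) :
    MultilinearMap Dual (fun _ : Fin (k + l) => Space n) Dual :=
  ((LinearMap.mul' Dual Dual).compMultilinearMap (S.domCoprod T)).domDomCongr finSumFinEquiv

/-- `Alt(T)(v₁, …, v_k) = (1/k!) ∑_σ sgn(σ) T(v_{σ(1)}, …, v_{σ(k)})`. -/
def altOf {n k : ℕ} (T : MultilinearMap Dual (fun _ : Fin k => Space n) Dual) : Alt n k :=
  algebraMap ℝ Dual (1 / (k ! : ℝ)) • MultilinearMap.alternatization T

/-- The wedge product `w ∧ η = ((k+l)!/(k! l!)) Alt(w ⊗ η)`. -/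
def wedge {n k l : ℕ} (w : Alt n k) (η : Alt n l) : Alt n (k + l) :=
  algebraMap ℝ Dual (((k + l)! : ℝ) / ((k ! : ℝ) * (l ! : ℝ))) •
    altOf (tensor w.toMultilinearMap η.toMultilinearMap)

/-- A module map to the dual numbers as an alternating `1`-tensor. -/
def oneForm {n : ℕ} (u : Space n →ₗ[Dual] Dual) : Alt n 1 :=
  AlternatingMap.ofSubsingleton Dual (Space n) Dual (0 : Fin 1) u

/-- The wedge product of a `1`-tensor and a `k`-tensor, as a `(k+1)`-tensor. -/
def oneWedge {n k : ℕ} (u : Space n →ₗ[Dual] Dual) (η : Alt n k) : Alt n (k + 1) :=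
  (wedge (oneForm u) η).domDomCongr (finCongr (Nat.add_comm 1 k))

/-- `dx^{i₁} ∧ ⋯ ∧ dx^{i_k}` (the constant `1` when `k = 0`). -/
def dx {n : ℕ} : {k : ℕ} → (Fin k → Fin n) → Alt n k
  | 0, _ => AlternatingMap.constOfIsEmpty Dual (Space n) (Fin 0) (1 : Dual)
  | _ + 1, I => oneWedge (LinearMap.proj (I 0)) (dx fun j => I j.succ)

/-- A field of alternating `k`-tensors on dual real `n`-space. -/
abbrev Form (n k : ℕ) : Type := Space n → Alt n k

/-- `w` is a dual real differentiable `k`-form on `A`: there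
`w = ∑_{i₁ < ⋯ < i_k} w_{i₁ … i_k} dx^{i₁} ∧ ⋯ ∧ dx^{i_k}` with coefficients that are dual real
differentiable on `A`. -/
def IsDiffForm {n k : ℕ} (w : Form n k) (A : Set (Space n)) : Prop :=
  ∃ f : (Fin k ↪o Fin n) → Space n → Dual,
    (∀ I, DualDiffOn (toSpaceOne (f I)) A) ∧ ∀ p ∈ A, w p = ∑ I, f I p • dx I

/-- The coefficient `w_{i₁ … i_k}` of a form: its value on `(e_{i₁}, …, e_{i_k})`. -/
def coeff {n k : ℕ} (w : Form n k) (I : Fin k ↪o Fin n) : Space n → Dual :=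
  fun p => w p fun j => Pi.single (I j) 1

/-- The `1`-tensor `df (p)` of a dual-valued function `f`. -/
def differential {n : ℕ} (f : Space n → Dual) (p : Space n) : Space n →ₗ[Dual] Dual :=
  LinearMap.proj 0 ∘ₗ dualDeriv (toSpaceOne f) p

/-- The dual real differential
`dw = ∑_{i₁ < ⋯ < i_k} d(w_{i₁ … i_k}) ∧ dx^{i₁} ∧ ⋯ ∧ dx^{i_k}`. -/
def d {n k : ℕ} (w : Form n k) : Form n (k + 1) :=
  fun p => ∑ I : Fin k ↪o Fin n, oneWedge (differential (coeff w I) p) (dx I)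

/-- The pullback `g^* w`. -/
def pullback {n m k : ℕ} (g : Space m → Space n) (w : Form n k) : Form m k :=
  fun p => (w (g p)).compLinearMap (dualDeriv g p)

/-! ### Singular cubes and chains -/

/-- `b = 1 + (-1)^{θ-1} r 1^#`. -/
def bPt (θ : Kind) (r : ℝ≥0) : Dual := mkDual 1 (θ.sgn * r)

/-- `[0, b]_θ^k` (for `k = 0` the one-point space). -/
def cube (θ : Kind) (r : ℝ≥0) (k : ℕ) : Set (Space k) := TRect θ (fun _ => 0) (fun _ => bPt θ r)

/-- A type `θ` singular `k`-cube in `A`: a function `[0, b]_θ^k → A` that extends to an open set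
as a dual real differentiable function whose derivative is dual real differentiable.  (The latter
makes pullbacks of dual real differentiable forms dual real differentiable.) -/
structure SingularCube (θ : Kind) (r : ℝ≥0) (k : ℕ) {n : ℕ} (A : Set (Space n)) where
  toFun : cube θ r k → Space n
  mem : ∀ x, toFun x ∈ A
  exists_ext : ∃ g : Space k → Space n, (∀ x : cube θ r k, g x = toFun x) ∧
    ∃ U : Set (Space k), IsOpen U ∧ cube θ r k ⊆ U ∧ TwiceDualDiffOn g U

/-- An extension of a singular cube to an open set.  At the points of `[0, b]_θ^k`, its values and
its dual real derivative are determined by the cube. -/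
def SingularCube.ext {θ : Kind} {r : ℝ≥0} {k n : ℕ} {A : Set (Space n)}
    (c : SingularCube θ r k A) : Space k → Space n := c.exists_ext.choose

/-- Type `θ` `k`-chains in `A`: formal finite sums of singular cubes with integer coefficients. -/
abbrev Chain (θ : Kind) (r : ℝ≥0) (k : ℕ) {n : ℕ} (A : Set (Space n)) : Type :=
  SingularCube θ r k A →₀ ℤ

/-- The `j`-th coordinate of a face: `α b` with `α ∈ {0, 1}`. -/
def facePt (θ : Kind) (r : ℝ≥0) (α : Fin 2) : Dual := (α.val : Dual) * bPt θ r

/-- The face map `I_{(j, α)} (x) = (x¹, …, x^{j-1}, α b, x^j, …, x^k)`. -/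
def faceMap (θ : Kind) (r : ℝ≥0) {k : ℕ} (j : Fin (k + 1)) (α : Fin 2) (x : Space k) :
    Space (k + 1) :=
  j.insertNth (α := fun _ => Dual) (facePt θ r α) x

theorem facePt_mem (θ : Kind) (r : ℝ≥0) (α : Fin 2) : facePt θ r α ∈ TIcc θ 0 (bPt θ r) := by
  have h : TLt θ 0 (bPt θ r) := by
    cases θ <;> left <;> simp [bPt, mkDual, Re, Ze, Kind.sgn]
  fin_cases α
  · simpa [facePt, TIcc, TLe] using Or.inl h
  · simpa [facePt, TIcc, TLe] using Or.inl h

theorem faceMap_mem (θ : Kind) (r : ℝ≥0) {k : ℕ} (j : Fin (k + 1)) (α : Fin 2) {x : Space k}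
    (hx : x ∈ cube θ r k) : faceMap θ r j α x ∈ cube θ r (k + 1) := by
  intro i
  refine Fin.succAboveCases j ?_ (fun l => ?_) i
  · simpa [faceMap] using facePt_mem θ r α
  · simpa [faceMap] using hx l

/-- The linear part of a face map. -/
def faceLin {k : ℕ} (j : Fin (k + 1)) : Space k →ₗ[Dual] Space (k + 1) where
  toFun x := j.insertNth (α := fun _ => Dual) 0 x
  map_add' x y := by
    funext i
    refine Fin.succAboveCases j ?_ (fun l => ?_) i <;> simp
  map_smul' a x := by
    funext i
    refine Fin.succAboveCases j ?_ (fun l => ?_) i <;> simp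

theorem faceMap_sub (θ : Kind) (r : ℝ≥0) {k : ℕ} (j : Fin (k + 1)) (α : Fin 2) (x y : Space k) :
    faceMap θ r j α x - faceMap θ r j α y = faceLin j (x - y) := by
  funext i
  refine Fin.succAboveCases j ?_ (fun l => ?_) i <;> simp [faceMap, faceLin]

theorem dnorm_faceLin {k : ℕ} (j : Fin (k + 1)) (x : Space k) : dnorm (faceLin j x) = dnorm x := by
  simp [dnorm, faceLin, Fin.sum_univ_succAbove _ j, Re, Ze]

theorem continuous_faceMap (θ : Kind) (r : ℝ≥0) {k : ℕ} (j : Fin (k + 1)) (α : Fin 2) :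
    Continuous (faceMap θ r j α) := by
  refine continuous_pi fun i => ?_
  refine Fin.succAboveCases j ?_ (fun l => ?_) i
  · simpa [faceMap] using continuous_const
  · simpa [faceMap] using continuous_apply l

theorem faceMap_injective (θ : Kind) (r : ℝ≥0) {k : ℕ} (j : Fin (k + 1)) (α : Fin 2) :
    Function.Injective (faceMap θ r j α) := by
  intro x y h
  funext l
  simpa [faceMap] using congrFun h (j.succAbove l)

theorem HasDualDeriv.comp_faceMap {k n : ℕ} {g : Space (k + 1) → Space n}
    {L : Space (k + 1) →ₗ[Dual] Space n} {θ : Kind} {r : ℝ≥0} {j : Fin (k + 1)} {α : Fin 2}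
    {a : Space k} (h : HasDualDeriv g L (faceMap θ r j α a)) :
    HasDualDeriv (fun x => g (faceMap θ r j α x)) (L ∘ₗ faceLin j) a := by
  have ht : Tendsto (faceMap θ r j α) (𝓝[≠] a) (𝓝[≠] (faceMap θ r j α a)) :=
    tendsto_nhdsWithin_of_tendsto_nhds_of_eventually_within _
      ((continuous_faceMap θ r j α).continuousAt.mono_left nhdsWithin_le_nhds)
      (eventually_nhdsWithin_of_forall fun x hx hxa => hx (faceMap_injective θ r j α hxa))
  refine (h.comp ht).congr fun x => ?_
  simp only [Function.comp_apply, faceMap_sub, dnorm_faceLin, LinearMap.comp_apply]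

theorem TwiceDualDiffOn.comp_faceMap {k n : ℕ} {g : Space (k + 1) → Space n}
    {U : Set (Space (k + 1))} (h : TwiceDualDiffOn g U) (θ : Kind) (r : ℝ≥0) (j : Fin (k + 1))
    (α : Fin 2) :
    TwiceDualDiffOn (fun x => g (faceMap θ r j α x)) (faceMap θ r j α ⁻¹' U) := by
  obtain ⟨L, hL, hL'⟩ := h
  refine ⟨fun a => L (faceMap θ r j α a) ∘ₗ faceLin j, fun a ha => (hL _ ha).comp_faceMap,
    fun v a ha => ?_⟩
  obtain ⟨M, hM⟩ := hL' (faceLin j v) _ ha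
  exact ⟨_, hM.comp_faceMap⟩

/-- The `(j, α)`-face `c ∘ I_{(j, α)}` of a singular cube. -/
def SingularCube.face {θ : Kind} {r : ℝ≥0} {k n : ℕ} {A : Set (Space n)}
    (c : SingularCube θ r (k + 1) A) (j : Fin (k + 1)) (α : Fin 2) : SingularCube θ r k A where
  toFun x := c.toFun ⟨faceMap θ r j α x, faceMap_mem θ r j α x.2⟩
  mem _ := c.mem _
  exists_ext := by
    obtain ⟨g, hg, U, hU, hcU, hgU⟩ := c.exists_ext
    exact ⟨fun x => g (faceMap θ r j α x), fun x => hg ⟨_, faceMap_mem θ r j α x.2⟩,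
      faceMap θ r j α ⁻¹' U, hU.preimage (continuous_faceMap θ r j α),
      fun x hx => hcU (faceMap_mem θ r j α hx), hgU.comp_faceMap θ r j α⟩

/-- The boundary `∑_j ∑_α (-1)^{j+α} c_{(j, α)}` of a singular cube (with `j` counted from `1`). -/
def SingularCube.boundary {θ : Kind} {r : ℝ≥0} {k n : ℕ} {A : Set (Space n)}
    (c : SingularCube θ r (k + 1) A) : Chain θ r k A :=
  ∑ j : Fin (k + 1), ∑ α : Fin 2, Finsupp.single (c.face j α) ((-1) ^ (j.val + 1 + α.val))

/-- The boundary of a chain. -/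
def Chain.boundary {θ : Kind} {r : ℝ≥0} {k n : ℕ} {A : Set (Space n)}
    (c : Chain θ r (k + 1) A) : Chain θ r k A :=
  Finsupp.sum c fun s a => a • s.boundary

/-! ### Integration of forms over chains -/

/-- The function `f` with `w = f dx¹ ∧ ⋯ ∧ dx^k`, for a `k`-form on dual real `k`-space. -/
def topCoeff {k : ℕ} (w : Form k k) : Space k → Dual := coeff w (RelEmbedding.refl _)

/-- The integral of the `k`-form `w` over the singular `k`-cube `c` is defined: the
function `f` with `c^* w = f dx¹ ∧ ⋯ ∧ dx^k` is type `θ` integrable on `[0, b]_θ^k`.  There is no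
condition if `k = 0`. -/
def CubeIntegrable {θ : Kind} {r : ℝ≥0} {n : ℕ} {A : Set (Space n)} :
    {k : ℕ} → Form n k → SingularCube θ r k A → Prop
  | 0, _, _ => True
  | _ + 1, w, c => TIntegrable θ (topCoeff (pullback c.ext w)) (fun _ => 0) (fun _ => bPt θ r)

/-- The integral of a `k`-form over a singular `k`-cube; for `k = 0` it is the value of the
form at the point that is the cube. -/
def cubeIntegral {θ : Kind} {r : ℝ≥0} {n : ℕ} {A : Set (Space n)} :
    {k : ℕ} → Form n k → SingularCube θ r k A → Dual
  | 0, w, c => w (c.toFun ⟨0, fun i => i.elim0⟩) Fin.elim0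
  | _ + 1, w, c => tIntegral θ (topCoeff (pullback c.ext w)) (fun _ => 0) (fun _ => bPt θ r)

/-- The integral of a `k`-form over each of the cubes of a `k`-chain is defined. -/
def ChainIntegrable {θ : Kind} {r : ℝ≥0} {n k : ℕ} {A : Set (Space n)} (w : Form n k)
    (c : Chain θ r k A) : Prop :=
  ∀ s ∈ c.support, CubeIntegrable w s

/-- The integral of a `k`-form over a `k`-chain `∑ aᵢ cᵢ`, which is `∑ aᵢ ∫_{cᵢ} w`. -/
def chainIntegral {θ : Kind} {r : ℝ≥0} {n k : ℕ} {A : Set (Space n)} (w : Form n k)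
    (c : Chain θ r k A) : Dual :=
  Finsupp.sum c fun s a => a • cubeIntegral w s

end DualStokes

end

/-!
A dual differentiable function `f` is real differentiable with a derivative that is linear over the
dual numbers, so in each variable its integral along a path depends only on the end points. Hence
`∏ i, (b i - a i)` times the integral of `f` over the real `k`-plane spanned by the diagonals of a
box `[a, b]` is additive under subdivision of the box. In the type `θ` order it lies between the
lower and upper bounds of `f` times the volume, so it is squeezed between the lower and upper sums
and is the type `θ` integral of `f`. On the diagonal plane the classical divergence theorem applies,
and Stokes' theorem follows because pullback commutes with `d`.
-/

noncomputable section

namespace DualStokes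

open MeasureTheory Set AffineMap

/-! ### The type `θ` order -/

section TypeOrder

@[simp] theorem Re_mkDual (a c : ℝ) : Re (mkDual a c) = a := by simp [Re, mkDual]

@[simp] theorem Ze_mkDual (a c : ℝ) : Ze (mkDual a c) = c := by simp [Ze, mkDual]

@[simp] theorem Re_mul (x y : Dual) : Re (x * y) = Re x * Re y := rfl

@[simp] theorem Ze_mul (x y : Dual) : Ze (x * y) = Re x * Ze y + Re y * Ze x := by
  simp [Re, Ze, TrivSqZeroExt.snd_mul, mul_comm]

@[simp] theorem Re_neg (x : Dual) : Re (-x) = -Re x := rfl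

@[simp] theorem Ze_neg (x : Dual) : Ze (-x) = -Ze x := rfl

theorem neg_mkDual (a c : ℝ) : -mkDual a c = mkDual (-a) (-c) := by simp [mkDual, add_comm]

theorem mkDual_Re_Ze (x : Dual) : mkDual (Re x) (Ze x) = x := TrivSqZeroExt.inl_fst_add_inr_snd_eq x

theorem norm_eq_abs_Re_add_abs_Ze (x : Dual) : ‖x‖ = |Re x| + |Ze x| := TrivSqZeroExt.norm_def x

theorem abs_Re_le_norm (x : Dual) : |Re x| ≤ ‖x‖ := by
  rw [norm_eq_abs_Re_add_abs_Ze]; exact le_add_of_nonneg_right (abs_nonneg _)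

theorem abs_Ze_le_norm (x : Dual) : |Ze x| ≤ ‖x‖ := by
  rw [norm_eq_abs_Re_add_abs_Ze]; exact le_add_of_nonneg_left (abs_nonneg _)

instance : FiniteDimensional ℝ Dual := inferInstanceAs (FiniteDimensional ℝ (ℝ × ℝ))

@[simp] theorem Kind.sgn_mul_sgn_mul (θ : Kind) (t : ℝ) : θ.sgn * (θ.sgn * t) = t := by
  cases θ <;> simp [Kind.sgn]

@[simp] theorem Kind.abs_sgn (θ : Kind) : |θ.sgn| = 1 := by cases θ <;> simp [Kind.sgn]

/-- The coordinates `(Re x, (-1)^(θ-1) Ze x)`, in which the type `θ` order becomes the product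
order of `ℝ × ℝ`. -/
def coord (θ : Kind) : Dual ≃L[ℝ] ℝ × ℝ :=
  LinearEquiv.toContinuousLinearEquiv
    { toFun x := (Re x, θ.sgn * Ze x)
      invFun p := mkDual p.1 (θ.sgn * p.2)
      map_add' _ _ := Prod.ext rfl (mul_add _ _ _)
      map_smul' _ _ := Prod.ext rfl (mul_left_comm _ _ _)
      left_inv x := by simp only [Kind.sgn_mul_sgn_mul, mkDual_Re_Ze]
      right_inv p := by simp }

variable {θ : Kind} {a b x y z : Dual}

theorem coord_apply (θ : Kind) (x : Dual) : coord θ x = (Re x, θ.sgn * Ze x) := rfl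

theorem coord_symm_apply (θ : Kind) (p : ℝ × ℝ) :
    (coord θ).symm p = mkDual p.1 (θ.sgn * p.2) := rfl

theorem coord_mul (θ : Kind) (x y : Dual) :
    coord θ (x * y) = ((coord θ x).1 * (coord θ y).1,
      (coord θ x).1 * (coord θ y).2 + (coord θ y).1 * (coord θ x).2) := by
  simp only [coord_apply, Re_mul, Ze_mul]
  ring_nf

theorem coord_lineMap (θ : Kind) (a b : Dual) (t : ℝ) :
    coord θ (lineMap a b t) = lineMap (coord θ a) (coord θ b) t :=
  apply_lineMap (coord θ).toAffineEquiv.toAffineMap a b t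

theorem norm_eq_coord (θ : Kind) (x : Dual) : ‖x‖ = |(coord θ x).1| + |(coord θ x).2| := by
  simp [coord_apply, norm_eq_abs_Re_add_abs_Ze, abs_mul]

theorem TLt_iff_coord_lt : TLt θ x y ↔ coord θ x < coord θ y := by
  rw [Prod.lt_iff]
  cases θ <;> simp only [coord_apply, TLt, Kind.sgn, one_mul, neg_one_mul, neg_le_neg_iff,
    neg_lt_neg_iff] <;> grind

theorem TLe_iff_coord_le : TLe θ x y ↔ coord θ x ≤ coord θ y := by
  rw [TLe, TLt_iff_coord_lt, le_iff_lt_or_eq, (coord θ).injective.eq_iff]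

theorem TIcc_eq_preimage (θ : Kind) (a b : Dual) :
    TIcc θ a b = coord θ ⁻¹' Icc (coord θ a) (coord θ b) := by
  ext; simp [TIcc, TLe_iff_coord_le]

theorem TLe.mul_nonneg (hx : TLe θ 0 x) (hy : TLe θ 0 y) : TLe θ 0 (x * y) := by
  rw [TLe_iff_coord_le, map_zero] at *
  rw [coord_mul]
  have ⟨hx₁, hx₂⟩ := hx
  have ⟨hy₁, hy₂⟩ := hy
  exact ⟨_root_.mul_nonneg hx₁ hy₁,
    add_nonneg (_root_.mul_nonneg hx₁ hy₂) (_root_.mul_nonneg hy₁ hx₂)⟩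

theorem TLe_iff_sub_nonneg : TLe θ x y ↔ TLe θ 0 (y - x) := by
  rw [TLe_iff_coord_le, TLe_iff_coord_le, map_zero, map_sub, sub_nonneg]

theorem TLe.mul_right (h : TLe θ x y) (hz : TLe θ 0 z) : TLe θ (x * z) (y * z) := by
  rw [TLe_iff_sub_nonneg, ← sub_mul]
  exact (TLe_iff_sub_nonneg.1 h).mul_nonneg hz

theorem TLe.prod_nonneg {ι : Type*} {s : Finset ι} {x : ι → Dual} (h : ∀ i ∈ s, TLe θ 0 (x i)) :
    TLe θ 0 (∏ i ∈ s, x i) :=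
  Finset.prod_induction x (TLe θ 0) (fun _ _ => TLe.mul_nonneg)
    (by simp [TLe_iff_coord_le, coord_apply, Re, Ze]) h

theorem TLe.sum {ι : Type*} {s : Finset ι} {x y : ι → Dual} (h : ∀ i ∈ s, TLe θ (x i) (y i)) :
    TLe θ (∑ i ∈ s, x i) (∑ i ∈ s, y i) := by
  simp only [TLe_iff_coord_le, map_sum] at *
  exact Finset.sum_le_sum h

theorem TLe.integral {α : Type*} [MeasurableSpace α] {μ : Measure α} {f g : α → Dual}
    (hf : Integrable f μ) (hg : Integrable g μ) (h : ∀ᵐ t ∂μ, TLe θ (f t) (g t)) :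
    TLe θ (∫ t, f t ∂μ) (∫ t, g t ∂μ) := by
  simp only [TLe_iff_coord_le, ← ContinuousLinearEquiv.integral_comp_comm] at *
  exact integral_mono_ae ((coord θ).toContinuousLinearMap.integrable_comp hf)
    ((coord θ).toContinuousLinearMap.integrable_comp hg) h

theorem norm_sub_le_of_mem_TIcc (hx : x ∈ TIcc θ a b) (hy : y ∈ TIcc θ a b) :
    ‖x - y‖ ≤ ‖b - a‖ := by
  have habs {s t p q : ℝ} (hs : p ≤ s ∧ s ≤ q) (ht : p ≤ t ∧ t ≤ q) : |s - t| ≤ |q - p| :=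
    (abs_sub_le_of_le_of_le hs.1 hs.2 ht.1 ht.2).trans (le_abs_self _)
  rw [TIcc_eq_preimage] at hx hy
  rw [norm_eq_coord θ, norm_eq_coord θ, map_sub, map_sub]
  exact add_le_add (habs ⟨hx.1.1, hx.2.1⟩ ⟨hy.1.1, hy.2.1⟩)
    (habs ⟨hx.1.2, hx.2.2⟩ ⟨hy.1.2, hy.2.2⟩)

theorem convex_TIcc (θ : Kind) (a b : Dual) : Convex ℝ (TIcc θ a b) := by
  rw [TIcc_eq_preimage]
  exact (convex_Icc _ _).linear_preimage (coord θ).toLinearEquiv.toLinearMap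

theorem isCompact_TIcc (θ : Kind) (a b : Dual) : IsCompact (TIcc θ a b) := by
  rw [TIcc_eq_preimage]
  exact (coord θ).toHomeomorph.isCompact_preimage.2 isCompact_Icc

theorem TLe_coord_symm_norm (θ : Kind) (x : Dual) : TLe θ x ((coord θ).symm (‖x‖, ‖x‖)) := by
  rw [TLe_iff_coord_le, ContinuousLinearEquiv.apply_symm_apply, norm_eq_coord θ]
  exact ⟨(le_abs_self _).trans (le_add_of_nonneg_right (abs_nonneg _)),
    (le_abs_self _).trans (le_add_of_nonneg_left (abs_nonneg _))⟩

section TRect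

variable {n : ℕ} {a b : Space n}

theorem TRect_eq_pi (θ : Kind) (a b : Space n) :
    TRect θ a b = univ.pi fun i => TIcc θ (a i) (b i) := by
  ext; simp [TRect]

theorem isCompact_TRect (θ : Kind) (a b : Space n) : IsCompact (TRect θ a b) := by
  rw [TRect_eq_pi]
  exact isCompact_univ_pi fun _ => isCompact_TIcc θ _ _

theorem left_mem_TRect (h : ∀ i, TLe θ (a i) (b i)) : a ∈ TRect θ a b := fun i => ⟨Or.inr rfl, h i⟩

theorem right_mem_TRect (h : ∀ i, TLe θ (a i) (b i)) : b ∈ TRect θ a b :=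
  fun i => ⟨h i, Or.inr rfl⟩

end TRect

end TypeOrder

/-! ### Dual differentiability over the reals -/

section DualDifferentiability

theorem dnorm_nonneg {n : ℕ} (x : Space n) : 0 ≤ dnorm x := Real.sqrt_nonneg _

theorem dnorm_le {n : ℕ} (x : Space n) : dnorm x ≤ Real.sqrt (2 * n) * ‖x‖ := by
  have hi (i : Fin n) : 2 * Re (x i) ^ 2 + Ze (x i) ^ 2 ≤ 2 * ‖x‖ ^ 2 := by
    have h := norm_le_pi_norm x i
    rw [norm_eq_abs_Re_add_abs_Ze] at h
    rw [← sq_abs (Re _), ← sq_abs (Ze _)]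
    nlinarith [abs_nonneg (Re (x i)), abs_nonneg (Ze (x i))]
  calc dnorm x = Real.sqrt (∑ i, (2 * Re (x i) ^ 2 + Ze (x i) ^ 2)) := by
        rw [dnorm, Finset.mul_sum, Finset.sum_add_distrib]
    _ ≤ Real.sqrt (2 * n * ‖x‖ ^ 2) := by
        refine Real.sqrt_le_sqrt ((Finset.sum_le_sum fun i _ => hi i).trans_eq ?_)
        simp only [Finset.sum_const, Finset.card_univ, Fintype.card_fin, nsmul_eq_mul]
        ring
    _ = Real.sqrt (2 * n) * ‖x‖ := by
        rw [Real.sqrt_mul (by positivity), Real.sqrt_sq (norm_nonneg x)]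

theorem norm_le_two_mul_dnorm {n : ℕ} (x : Space n) : ‖x‖ ≤ 2 * dnorm x := by
  refine (pi_norm_le_iff_of_nonneg (mul_nonneg zero_le_two (dnorm_nonneg x))).2 fun i => ?_
  have hRe : Re (x i) ^ 2 ≤ ∑ i, Re (x i) ^ 2 :=
    Finset.single_le_sum (fun i _ => sq_nonneg (Re (x i))) (Finset.mem_univ i)
  have hZe : Ze (x i) ^ 2 ≤ ∑ i, Ze (x i) ^ 2 :=
    Finset.single_le_sum (fun i _ => sq_nonneg (Ze (x i))) (Finset.mem_univ i)
  have h₁ : |Re (x i)| ≤ dnorm x :=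
    Real.abs_le_sqrt (by linarith [sq_nonneg (Re (x i)), sq_nonneg (Ze (x i))])
  have h₂ : |Ze (x i)| ≤ dnorm x :=
    Real.abs_le_sqrt (by linarith [sq_nonneg (Re (x i)), sq_nonneg (Ze (x i))])
  rw [norm_eq_abs_Re_add_abs_Ze]
  linarith

variable {n m : ℕ}

theorem isTheta_dnorm {α : Type*} (l : Filter α) (f : α → Space n) :
    (fun x => dnorm (f x)) =Θ[l] f :=
  ⟨.of_bound _ (.of_forall fun x => by
      simpa only [Real.norm_of_nonneg (dnorm_nonneg _)] using dnorm_le (f x)),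
    .of_bound 2 (.of_forall fun x => by
      simpa only [Real.norm_of_nonneg (dnorm_nonneg _)] using norm_le_two_mul_dnorm (f x))⟩

theorem hasDualDeriv_iff_hasFDerivAt {f : Space n → Space m} {L : Space n →ₗ[Dual] Space m}
    {a : Space n} : HasDualDeriv f L a ↔
      HasFDerivAt f (ContinuousLinearMap.restrictScalars ℝ ⟨L, L.continuous_on_pi⟩) a := by
  rw [← hasFDerivWithinAt_univ, ← hasFDerivWithinAt_sdiff_singleton a, ← compl_eq_univ_sdiff,
    hasFDerivWithinAt_iff_isLittleO, ← (isTheta_dnorm _ _).isLittleO_congr_left,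
    ← (isTheta_dnorm _ _).isLittleO_congr_right]
  refine (Asymptotics.isLittleO_iff_tendsto' ?_).symm
  filter_upwards [self_mem_nhdsWithin] with x hx h0
  have hle := norm_le_two_mul_dnorm (x - a)
  rw [h0, mul_zero, norm_le_zero_iff, sub_eq_zero] at hle
  exact absurd hle hx

section DualDifferentiableAt

variable {E : Type*} [NormedAddCommGroup E] [NormedSpace ℝ E] [Module Dual E]
  [IsScalarTower ℝ Dual E]

/-- Dual real differentiability as real Fréchet differentiability with a derivative that is linear
over the dual numbers.  The target may be `Space m` as well as `Dual` itself. -/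
def DualDifferentiableAt (f : Space n → E) (a : Space n) : Prop :=
  ∃ L : Space n →L[Dual] E, HasFDerivAt f (L.restrictScalars ℝ) a

variable {f g : Space n → E} {a : Space n}

theorem DualDifferentiableAt.differentiableAt (h : DualDifferentiableAt f a) :
    DifferentiableAt ℝ f a :=
  h.choose_spec.differentiableAt

theorem DualDifferentiableAt.fderiv_smul (h : DualDifferentiableAt f a) (z : Dual) (v : Space n) :
    fderiv ℝ f a (z • v) = z • fderiv ℝ f a v := by
  obtain ⟨L, hL⟩ := h
  simp [hL.fderiv]

theorem DualDifferentiableAt.congr_of_eventuallyEq (h : DualDifferentiableAt f a)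
    (hfg : g =ᶠ[𝓝 a] f) : DualDifferentiableAt g a :=
  ⟨_, h.choose_spec.congr_of_eventuallyEq hfg⟩

theorem DualDifferentiableAt.comp {f : Space m → E} {g : Space n → Space m}
    (hf : DualDifferentiableAt f (g a)) (hg : DualDifferentiableAt g a) :
    DualDifferentiableAt (fun x => f (g x)) a := by
  obtain ⟨L, hL⟩ := hf
  obtain ⟨M, hM⟩ := hg
  exact ⟨L.comp M, hL.comp a hM⟩

theorem DualDifferentiableAt.apply {f : Space n → Space m} (h : DualDifferentiableAt f a)
    (i : Fin m) : DualDifferentiableAt (fun x => f x i) a := by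
  obtain ⟨L, hL⟩ := h
  exact ⟨(ContinuousLinearMap.proj i).comp L, hasFDerivAt_pi'.1 hL i⟩

theorem DualDifferentiableAt.const (c : E) (a : Space n) :
    DualDifferentiableAt (fun _ : Space n => c) a :=
  ⟨0, hasFDerivAt_const c a⟩

theorem DualDifferentiableAt.add (hf : DualDifferentiableAt f a) (hg : DualDifferentiableAt g a) :
    DualDifferentiableAt (fun x => f x + g x) a := by
  obtain ⟨L, hL⟩ := hf
  obtain ⟨M, hM⟩ := hg
  exact ⟨L + M, hL.add hM⟩

theorem DualDifferentiableAt.neg (hf : DualDifferentiableAt f a) :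
    DualDifferentiableAt (-f) a := by
  obtain ⟨L, hL⟩ := hf
  exact ⟨-L, hL.neg⟩

theorem DualDifferentiableAt.const_zsmul (hf : DualDifferentiableAt f a) (z : ℤ) :
    DualDifferentiableAt (fun x => z • f x) a := by
  obtain ⟨L, hL⟩ := hf
  exact ⟨z • L, hL.const_smul z⟩

theorem DualDifferentiableAt.mul {f g : Space n → Dual} (hf : DualDifferentiableAt f a)
    (hg : DualDifferentiableAt g a) : DualDifferentiableAt (fun x => f x * g x) a := by
  obtain ⟨L, hL⟩ := hf
  obtain ⟨M, hM⟩ := hg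
  exact ⟨f a • M + g a • L, hL.mul hM⟩

theorem DualDifferentiableAt.sum {ι : Type*} {s : Finset ι} {f : ι → Space n → E}
    (h : ∀ i ∈ s, DualDifferentiableAt (f i) a) :
    DualDifferentiableAt (fun x => ∑ i ∈ s, f i x) a := by
  simpa only [Finset.sum_fn] using Finset.sum_induction f (DualDifferentiableAt · a)
    (fun _ _ => .add) (.const 0 a) h

theorem DualDifferentiableAt.prod {ι : Type*} {s : Finset ι} {f : ι → Space n → Dual}
    (h : ∀ i ∈ s, DualDifferentiableAt (f i) a) :
    DualDifferentiableAt (fun x => ∏ i ∈ s, f i x) a := by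
  simpa only [Finset.prod_fn] using Finset.prod_induction f (DualDifferentiableAt · a)
    (fun _ _ => .mul) (.const 1 a) h

theorem dualDifferentiableAt_iff_exists_hasDualDeriv {f : Space n → Space m} :
    DualDifferentiableAt f a ↔ ∃ L : Space n →ₗ[Dual] Space m, HasDualDeriv f L a :=
  ⟨fun ⟨L, hL⟩ => ⟨L, hasDualDeriv_iff_hasFDerivAt.2 hL⟩,
    fun ⟨_, hL⟩ => ⟨_, hasDualDeriv_iff_hasFDerivAt.1 hL⟩⟩

theorem dualDifferentiableAt_toSpaceOne {f : Space n → Dual} :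
    DualDifferentiableAt (toSpaceOne f) a ↔ DualDifferentiableAt f a :=
  ⟨fun h => h.apply 0, fun ⟨L, hL⟩ => ⟨.pi fun _ => L, hasFDerivAt_pi.2 fun _ => hL⟩⟩

theorem DualDifferentiableAt.dualDeriv_apply {f : Space n → Space m}
    (h : DualDifferentiableAt f a) (v : Space n) : dualDeriv f a v = fderiv ℝ f a v := by
  have hex := dualDifferentiableAt_iff_exists_hasDualDeriv.1 h
  rw [dualDeriv, dif_pos hex, (hasDualDeriv_iff_hasFDerivAt.1 hex.choose_spec).fderiv]
  rfl

theorem DualDifferentiableAt.differential_apply {f : Space n → Dual}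
    (h : DualDifferentiableAt f a) (v : Space n) : differential f a v = fderiv ℝ f a v := by
  have h' := dualDifferentiableAt_toSpaceOne.2 h
  have hproj := (hasFDerivAt_pi'.1 h'.differentiableAt.hasFDerivAt 0).fderiv
  rw [differential, LinearMap.comp_apply, h'.dualDeriv_apply]
  exact (DFunLike.congr_fun hproj v).symm

theorem continuousOn_of_dualDifferentiableAt {S : Set (Space n)}
    (h : ∀ x ∈ S, DualDifferentiableAt f x) : ContinuousOn f S :=
  fun x hx => (h x hx).differentiableAt.continuousAt.continuousWithinAt

end DualDifferentiableAt

/-! ### Path independence -/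

theorem sub_mul_integral_lineMap_add {A : Type*} [NormedCommRing A] [NormedAlgebra ℝ A]
    [CompleteSpace A] {s : Set A} (hs : Convex ℝ s) {F F' : A → A}
    (hF : ∀ z ∈ s, HasFDerivWithinAt F (ContinuousLinearMap.mul ℝ A (F' z)) s z) {a b c : A}
    (ha : a ∈ s) (hb : b ∈ s) (hc : c ∈ s) :
    (b - a) * (∫ t in (0 : ℝ)..1, F (lineMap a b t)) +
      (c - b) * (∫ t in (0 : ℝ)..1, F (lineMap b c t)) =
      (c - a) * ∫ t in (0 : ℝ)..1, F (lineMap a c t) := by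
  have hcurve {p q : A} (hp : p ∈ s) (hq : q ∈ s) :
      (q - p) * (∫ t in (0 : ℝ)..1, F (lineMap p q t)) =
        ∫ᶜ z in .segment p q, ContinuousLinearMap.mul ℝ A (F z) := by
    have hcont : ContinuousOn (fun t : ℝ => F (lineMap p q t)) (uIcc 0 1) := by
      rw [uIcc_of_le zero_le_one]
      exact ContinuousOn.comp (fun z hz => (hF z hz).continuousWithinAt)
        lineMap_continuous.continuousOn fun t ht => hs.lineMap_mem hp hq ht
    rw [curveIntegral_segment]
    simp only [ContinuousLinearMap.mul_apply', mul_comm _ (q - p)]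
    exact ((ContinuousLinearMap.mul ℝ A (q - p)).intervalIntegral_comp_comm
      hcont.intervalIntegrable).symm
  rw [hcurve ha hb, hcurve hb hc, hcurve ha hc]
  -- The `1`-form `F dz` is closed because `A` is commutative.
  refine hs.curveIntegral_segment_add_eq_of_hasFDerivWithinAt_symmetric
    (fun z hz => (ContinuousLinearMap.mul ℝ A).hasFDerivAt.comp_hasFDerivWithinAt z (hF z hz))
    (fun z _ x _ y _ => ?_) ha hb hc
  simp [mul_right_comm]

end DualDifferentiability

/-! ### The integral over the diagonal plane of a box -/

section BoxIntegral

theorem measurePreserving_update {ι : Type*} [Fintype ι] [DecidableEq ι] {α : ι → Type*}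
    [∀ i, MeasurableSpace (α i)] (μ : ∀ i, Measure (α i)) [∀ i, IsProbabilityMeasure (μ i)]
    (i : ι) :
    MeasurePreserving (fun p : (∀ j, α j) × α i => Function.update p.1 i p.2)
      ((Measure.pi μ).prod (μ i)) (Measure.pi μ) := by
  have hmeas : Measurable fun p : (∀ j, α j) × α i => Function.update p.1 i p.2 :=
    measurable_update'
  refine ⟨hmeas, (Measure.pi_eq fun s hs => ?_).symm⟩
  have hpre : (fun p : (∀ j, α j) × α i => Function.update p.1 i p.2) ⁻¹' univ.pi s =
      univ.pi (Function.update s i univ) ×ˢ s i := by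
    ext p
    simp only [mem_preimage, mem_univ_pi, mem_prod,
      Function.forall_update_iff s (p := fun j t => p.1 j ∈ t),
      Function.forall_update_iff p.1 (p := fun j x => x ∈ s j)]
    tauto
  rw [Measure.map_apply hmeas (.univ_pi hs), hpre, Measure.prod_prod, Measure.pi_pi,
    ← Finset.prod_erase_mul _ _ (Finset.mem_univ i),
    ← Finset.prod_erase_mul _ _ (Finset.mem_univ i), Function.update_self, measure_univ, mul_one]
  congr 1
  exact Finset.prod_congr rfl fun j hj => by rw [Function.update_of_ne (Finset.ne_of_mem_erase hj)]

section unitCube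

variable {k : ℕ} {E : Type*} [NormedAddCommGroup E]

theorem volume_restrict_unitCube (k : ℕ) : (volume : Measure (Fin k → ℝ)).restrict (Icc 0 1) =
    Measure.pi fun _ => volume.restrict (Icc (0 : ℝ) 1) := by
  rw [← Measure.restrict_pi_pi, ← volume_pi, ← pi_univ_Icc]
  rfl

instance isProbabilityMeasure_restrict_Icc_zero_one :
    IsProbabilityMeasure (volume.restrict (Icc (0 : ℝ) 1)) :=
  ⟨by simp⟩

variable {g : (Fin k → ℝ) → E} (hg : IntegrableOn g (Icc 0 1)) (i : Fin k)
include hg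

theorem integrable_comp_update_unitCube :
    Integrable (fun p : (Fin k → ℝ) × ℝ => g (Function.update p.1 i p.2))
      ((volume.restrict (Icc 0 1)).prod (volume.restrict (Icc 0 1))) := by
  rw [IntegrableOn, volume_restrict_unitCube] at hg
  rw [volume_restrict_unitCube]
  exact (measurePreserving_update _ i).integrable_comp_of_integrable hg

variable [NormedSpace ℝ E]

theorem integrableOn_unitCube_integral_update :
    IntegrableOn (fun t => ∫ s in (0 : ℝ)..1, g (Function.update t i s)) (Icc 0 1) := by
  simpa only [intervalIntegral.integral_of_le zero_le_one, integral_Icc_eq_integral_Ioc,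
    IntegrableOn] using (integrable_comp_update_unitCube hg i).integral_prod_left

theorem setIntegral_unitCube_update :
    ∫ t in Icc 0 1, ∫ s in (0 : ℝ)..1, g (Function.update t i s) = ∫ t in Icc 0 1, g t := by
  have hupd := measurePreserving_update (fun _ : Fin k => volume.restrict (Icc (0 : ℝ) 1)) i
  rw [← volume_restrict_unitCube] at hupd
  simp only [intervalIntegral.integral_of_le zero_le_one, ← integral_Icc_eq_integral_Ioc]
  rw [← integral_prod _ (integrable_comp_update_unitCube hg i),
    ← integral_map hupd.measurable.aemeasurable (hupd.map_eq.symm ▸ hg.aestronglyMeasurable),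
    hupd.map_eq]

end unitCube

/-- The point with parameters `t` on the diagonal plane of the box with corners `a` and `b`. -/
def diag {k : ℕ} (a b : Space k) (t : Fin k → ℝ) : Space k := fun i => lineMap (a i) (b i) (t i)

/-- The integral of `f dx¹ ∧ ⋯ ∧ dxᵏ` over the diagonal plane of the box with corners `a` and `b`,
pulled back along `diag a b`. -/
def boxIntegral {k : ℕ} (f : Space k → Dual) (a b : Space k) : Dual :=
  (∏ i, (b i - a i)) * ∫ t in Icc (0 : Fin k → ℝ) 1, f (diag a b t)

variable {k : ℕ} {s : Fin k → Set Dual} {f : Space k → Dual} {a b : Space k}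

theorem continuous_diag (a b : Space k) : Continuous (diag a b) := by
  unfold diag; fun_prop

theorem diag_mem (hs : ∀ i, Convex ℝ (s i)) (ha : a ∈ univ.pi s) (hb : b ∈ univ.pi s)
    {t : Fin k → ℝ} (ht : t ∈ Icc (0 : Fin k → ℝ) 1) : diag a b t ∈ univ.pi s :=
  fun i _ => (hs i).lineMap_mem (ha i trivial) (hb i trivial) ⟨ht.1 i, ht.2 i⟩

theorem integrableOn_comp_diag (hs : ∀ i, Convex ℝ (s i)) (hf : ContinuousOn f (univ.pi s))
    (ha : a ∈ univ.pi s) (hb : b ∈ univ.pi s) :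
    IntegrableOn (fun t => f (diag a b t)) (Icc (0 : Fin k → ℝ) 1) :=
  (hf.comp (continuous_diag a b).continuousOn fun _ ht => diag_mem hs ha hb ht).integrableOn_compact
    isCompact_Icc

theorem diag_update (a b : Space k) (i : Fin k) (t : Fin k → ℝ) (r : ℝ) :
    diag a b (Function.update t i r) =
      Function.update (diag a b t) i (lineMap (a i) (b i) r) := by
  ext1 j
  obtain rfl | h := eq_or_ne j i <;> simp [diag, *]

theorem update_diag_update_left (a b : Space k) (i : Fin k) (c z : Dual) (t : Fin k → ℝ) :
    Function.update (diag (Function.update a i c) b t) i z = Function.update (diag a b t) i z := by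
  ext1 j
  obtain rfl | h := eq_or_ne j i <;> simp [diag, *]

theorem update_diag_update_right (a b : Space k) (i : Fin k) (c z : Dual) (t : Fin k → ℝ) :
    Function.update (diag a (Function.update b i c) t) i z = Function.update (diag a b t) i z := by
  ext1 j
  obtain rfl | h := eq_or_ne j i <;> simp [diag, *]

section slice

variable (hs : ∀ i, Convex ℝ (s i)) (hf : ContinuousOn f (univ.pi s))
  (ha : a ∈ univ.pi s) (hb : b ∈ univ.pi s) (i : Fin k)
include hs hf ha hb

theorem integrableOn_slice :
    IntegrableOn (fun t => (b i - a i) *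
      ∫ r in (0 : ℝ)..1, f (Function.update (diag a b t) i (lineMap (a i) (b i) r)))
      (Icc (0 : Fin k → ℝ) 1) := by
  have h := integrableOn_unitCube_integral_update (integrableOn_comp_diag hs hf ha hb) i
  simp only [diag_update] at h
  exact h.const_mul _

theorem boxIntegral_eq_integral_slice :
    boxIntegral f a b = (∏ l ∈ Finset.univ.erase i, (b l - a l)) *
      ∫ t in Icc (0 : Fin k → ℝ) 1, (b i - a i) *
        ∫ r in (0 : ℝ)..1, f (Function.update (diag a b t) i (lineMap (a i) (b i) r)) := by
  have hg := integrableOn_comp_diag hs hf ha hb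
  have hmul := integral_const_mul_of_integrable (c := b i - a i)
    (integrableOn_unitCube_integral_update hg i)
  rw [setIntegral_unitCube_update hg] at hmul
  simp only [diag_update] at hmul
  rw [boxIntegral, hmul, ← mul_assoc, Finset.prod_erase_mul _ _ (Finset.mem_univ i)]

end slice

theorem DualDifferentiableAt.hasFDerivAt_update {x : Space k} {i : Fin k} {z : Dual}
    (h : DualDifferentiableAt f (Function.update x i z)) :
    HasFDerivAt (fun z => f (Function.update x i z))
      (ContinuousLinearMap.mul ℝ Dual (fderiv ℝ f (Function.update x i z) (Pi.single i 1))) z := by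
  refine (h.differentiableAt.hasFDerivAt.comp z (_root_.hasFDerivAt_update x z)).congr_fderiv ?_
  ext1 v
  have hv : (Pi.single i v : Space k) = v • Pi.single i 1 := by
    rw [← Pi.single_smul, smul_eq_mul, mul_one]
  rw [ContinuousLinearMap.mul_apply', mul_comm, ← smul_eq_mul, ← h.fderiv_smul, ← hv]
  refine congrArg (fderiv ℝ f _) (funext fun j => ?_)
  obtain rfl | hj := eq_or_ne j i <;> simp [*]

theorem boxIntegral_update_add (hs : ∀ i, Convex ℝ (s i))
    (hf : ∀ x ∈ univ.pi s, DualDifferentiableAt f x) (ha : a ∈ univ.pi s) (hb : b ∈ univ.pi s)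
    (i : Fin k) {c : Dual} (hc : c ∈ s i) :
    boxIntegral f a (Function.update b i c) + boxIntegral f (Function.update a i c) b =
      boxIntegral f a b := by
  have hcont := continuousOn_of_dualDifferentiableAt hf
  have ha' := (update_mem_pi_iff_of_mem ha).2 fun _ => hc
  have hb' := (update_mem_pi_iff_of_mem hb).2 fun _ => hc
  have hint₁ := integrableOn_slice hs hcont ha hb' i
  have hint₂ := integrableOn_slice hs hcont ha' hb i
  rw [boxIntegral_eq_integral_slice hs hcont ha hb i,
    boxIntegral_eq_integral_slice hs hcont ha hb' i,
    boxIntegral_eq_integral_slice hs hcont ha' hb i]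
  have hvol₁ : ∏ l ∈ Finset.univ.erase i, (Function.update b i c l - a l) =
      ∏ l ∈ Finset.univ.erase i, (b l - a l) :=
    Finset.prod_congr rfl fun l hl => by rw [Function.update_of_ne (Finset.ne_of_mem_erase hl)]
  have hvol₂ : ∏ l ∈ Finset.univ.erase i, (b l - Function.update a i c l) =
      ∏ l ∈ Finset.univ.erase i, (b l - a l) :=
    Finset.prod_congr rfl fun l hl => by rw [Function.update_of_ne (Finset.ne_of_mem_erase hl)]
  simp only [update_diag_update_left, update_diag_update_right, Function.update_self]
    at hint₁ hint₂ ⊢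
  rw [hvol₁, hvol₂, ← mul_add, ← integral_add hint₁ hint₂]
  congr 1
  refine setIntegral_congr_fun measurableSet_Icc fun t ht => ?_
  have hslice (z) (hz : z ∈ s i) :=
    (hf _ ((update_mem_pi_iff_of_mem (diag_mem hs ha hb ht)).2 fun _ => hz)).hasFDerivAt_update
  exact sub_mul_integral_lineMap_add (hs i) (fun z hz => (hslice z hz).hasFDerivWithinAt)
    (ha i trivial) hc (hb i trivial)

section grid

variable {M : Type*} [AddCommGroup M]

theorem sum_fin_of_additive {N : ℕ} {h : Fin (N + 1) → Fin (N + 1) → M}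
    (hadd : ∀ x y z, h x y + h y z = h x z) :
    ∑ j : Fin N, h j.castSucc j.succ = h 0 (Fin.last N) := by
  induction N with
  | zero => simpa using (add_eq_left.1 (hadd 0 0 0)).symm
  | succ N ih =>
    rw [Fin.sum_univ_castSucc]
    exact (congrArg (· + _) (ih fun x y z => hadd x.castSucc y.castSucc z.castSucc)).trans
      (hadd _ _ _)

theorem sum_grid_of_additive {k : ℕ} {N : Fin k → ℕ}
    {G : (∀ i, Fin (N i + 1)) → (∀ i, Fin (N i + 1)) → M}
    (hG : ∀ m n i c, G m (Function.update n i c) + G (Function.update m i c) n = G m n) :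
    ∑ j : ∀ i, Fin (N i), G (fun i => (j i).castSucc) (fun i => (j i).succ) =
      G 0 fun i => Fin.last (N i) := by
  induction k with
  | zero =>
    rw [Fintype.sum_unique]
    congr! 1
  | succ k ih =>
    have htail (x y : Fin (N 0 + 1)) := ih (N := fun i => N i.succ)
      (G := fun m n => G (Fin.cons x m) (Fin.cons y n)) fun m n i c => by
        simpa only [Fin.cons_update] using hG (Fin.cons x m) (Fin.cons y n) i.succ c
    have hhead := sum_fin_of_additive (N := N 0)
      (h := fun x y => G (Fin.cons x 0) (Fin.cons y fun i => Fin.last (N i.succ)))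
      fun x y z => by
        simpa only [Fin.update_cons_zero] using
          hG (Fin.cons x 0) (Fin.cons z fun i => Fin.last (N i.succ)) 0 y
    rw [← (Fin.consEquiv fun i => Fin (N i)).sum_comp, Fintype.sum_prod_type]
    have hcons {α : Fin (k + 1) → Type} (u : ∀ i, α i) :
        u = Fin.cons (u 0) fun i => u i.succ := (Fin.cons_self_tail u).symm
    rw [hcons (0 : ∀ i, Fin (N i + 1)), hcons fun i => Fin.last (N i)]
    refine .trans (Finset.sum_congr rfl fun x _ => .trans (Finset.sum_congr rfl fun y _ => ?_)
      (htail x.castSucc x.succ)) hhead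
    congr 1 <;> exact hcons _

end grid

theorem TPartition.monotone_coord {θ : Kind} {a b : Dual} (P : TPartition θ a b) :
    Monotone fun j => coord θ (P.pt j) :=
  Fin.monotone_iff_le_succ.2 fun j => (TLt_iff_coord_lt.1 (P.lt j)).le

theorem TPartition.pt_mem {θ : Kind} {a b : Dual} (P : TPartition θ a b) (j : Fin (P.N + 1)) :
    P.pt j ∈ TIcc θ a b := by
  have h : coord θ (P.pt j) ∈ Icc (coord θ (P.pt 0)) (coord θ (P.pt (Fin.last P.N))) :=
    ⟨P.monotone_coord (Fin.zero_le j), P.monotone_coord (Fin.le_last j)⟩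
  rwa [P.pt_zero, P.pt_last, ← mem_preimage, ← TIcc_eq_preimage] at h

theorem sum_boxIntegral {θ : Kind} {a b : Space k}
    (hf : ∀ x ∈ TRect θ a b, DualDifferentiableAt f x) (P : RectPartition θ a b) :
    ∑ j : RectPartition.Index P, boxIntegral f (fun i => (P i).pt (j i).castSucc)
      (fun i => (P i).pt (j i).succ) = boxIntegral f a b := by
  rw [TRect_eq_pi] at hf
  have h := sum_grid_of_additive (N := fun i => (P i).N)
    (G := fun m n => boxIntegral f (fun i => (P i).pt (m i)) fun i => (P i).pt (n i))
    fun m n i c => by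
      simpa only [Function.apply_update fun i => (P i).pt] using
        boxIntegral_update_add (fun i => convex_TIcc θ (a i) (b i)) hf
          (fun l _ => (P l).pt_mem (m l)) (fun l _ => (P l).pt_mem (n l)) i ((P i).pt_mem c)
  simpa only [Pi.zero_apply, TPartition.pt_zero, TPartition.pt_last] using h

end BoxIntegral

/-! ### Darboux sums -/

section Darboux

variable {θ : Kind} {k : ℕ} {f g : Space k → Dual} {a b : Space k} {S : Set (Space k)}
  {x : Space k} {z : Dual}

theorem infOn_neg (g : Space k → ℝ) (S : Set (Space k)) :
    infOn (fun x => -g x) S = -supOn g S := by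
  rw [infOn, supOn, ← Real.sInf_neg, ← image_neg_eq_neg, image_image]

/-- The greatest lower bound of `f` on `S` for the type `θ` order. -/
def lowerBound (θ : Kind) (f : Space k → Dual) (S : Set (Space k)) : Dual :=
  (coord θ).symm (infOn (fun x => (coord θ (f x)).1) S, infOn (fun x => (coord θ (f x)).2) S)

theorem lowerSum_eq (f : Space k → Dual) (P : RectPartition θ a b) :
    lowerSum f θ P = ∑ j : RectPartition.Index P,
      lowerBound θ f (RectPartition.sub P j) * RectPartition.vol P j := by
  cases θ
  · simp [lowerSum, lowerBound, coord_apply, coord_symm_apply, Kind.sgn]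
  · simp [lowerSum, lowerBound, coord_apply, coord_symm_apply, Kind.sgn, infOn_neg]

theorem upperSum_eq_neg_lowerSum_neg (f : Space k → Dual) (P : RectPartition θ a b) :
    upperSum f θ P = -lowerSum (-f) θ P := by
  have hsup (g : Space k → ℝ) (S : Set (Space k)) : supOn (fun x => -g x) S = -infOn g S := by
    simpa only [neg_neg] using (congrArg Neg.neg (infOn_neg (fun x => -g x) S)).symm
  cases θ <;>
  simp only [upperSum, lowerSum, Pi.neg_apply, Re_neg, Ze_neg, infOn_neg, hsup, ← neg_mkDual,
    neg_mul, Finset.sum_neg_distrib, neg_neg]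

theorem upperIntegral_eq_neg_lowerIntegral_neg (f : Space k → Dual) (a b : Space k) (θ : Kind) :
    upperIntegral f a b θ = -lowerIntegral (-f) a b θ := by
  have hsup {ι : Type} (u : ι → ℝ) : ⨆ i, -u i = -⨅ i, u i := by
    simpa using (Real.mul_iInf_of_nonpos (by norm_num : (-1 : ℝ) ≤ 0) u).symm
  have hinf {ι : Type} (u : ι → ℝ) : ⨅ i, -u i = -⨆ i, u i := by
    simpa using (Real.mul_iSup_of_nonpos (by norm_num : (-1 : ℝ) ≤ 0) u).symm
  cases θ <;>
  simp only [upperIntegral, lowerIntegral, upperSum_eq_neg_lowerSum_neg, Re_neg, Ze_neg,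
    neg_mkDual, hsup, hinf]

theorem lowerIntegral_eq_of_isLUB
    (hz : IsLUB (range fun P : RectPartition θ a b => coord θ (lowerSum f θ P)) (coord θ z)) :
    lowerIntegral f a b θ = z := by
  have : Nonempty (RectPartition θ a b) := range_nonempty_iff_nonempty.1 hz.nonempty
  rw [isLUB_prod, ← range_comp, ← range_comp] at hz
  have hRe : ⨆ P : RectPartition θ a b, Re (lowerSum f θ P) = Re z := hz.1.ciSup_eq
  have hZe : ⨆ P : RectPartition θ a b, θ.sgn * Ze (lowerSum f θ P) = θ.sgn * Ze z :=
    hz.2.ciSup_eq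
  cases θ
  · simp only [Kind.sgn, one_mul] at hZe
    rw [lowerIntegral, hRe, hZe, mkDual_Re_Ze]
  · rw [Kind.sgn, ← Real.mul_iInf_of_nonpos (by norm_num)] at hZe
    rw [lowerIntegral, hRe, mul_left_cancel₀ (by norm_num) hZe, mkDual_Re_Ze]

section lowerBound

variable (hS : IsCompact S) (hf : ContinuousOn f S)
include hS hf

theorem isGLB_lowerBound (hne : S.Nonempty) :
    IsGLB ((fun x => coord θ (f x)) '' S) (coord θ (lowerBound θ f S)) := by
  have hglb {u : Dual → ℝ} (hu : Continuous u) :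
      IsGLB ((fun x => u (f x)) '' S) (infOn (fun x => u (f x)) S) :=
    isGLB_csInf (hne.image _) (hS.image_of_continuousOn (hu.comp_continuousOn hf)).bddBelow
  rw [isGLB_prod, image_image, image_image, lowerBound, ContinuousLinearEquiv.apply_symm_apply]
  exact ⟨hglb (coord θ).continuous.fst, hglb (coord θ).continuous.snd⟩

theorem lowerBound_TLe (hx : x ∈ S) : TLe θ (lowerBound θ f S) (f x) :=
  TLe_iff_coord_le.2 ((isGLB_lowerBound hS hf ⟨x, hx⟩).1 (mem_image_of_mem _ hx))

theorem TLe_lowerBound (hne : S.Nonempty) (h : ∀ x ∈ S, TLe θ z (f x)) :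
    TLe θ z (lowerBound θ f S) :=
  TLe_iff_coord_le.2 <| (isGLB_lowerBound hS hf hne).2 <|
    forall_mem_image.2 fun x hx => TLe_iff_coord_le.1 (h x hx)

end lowerBound

theorem boxIntegral_neg (f : Space k → Dual) (a b : Space k) :
    boxIntegral (-f) a b = -boxIntegral f a b := by
  simp only [boxIntegral, Pi.neg_apply, integral_neg, mul_neg]

theorem boxIntegral_zsmul (m : ℤ) (f : Space k → Dual) (a b : Space k) :
    boxIntegral (fun x => m • f x) a b = m • boxIntegral f a b := by
  simp only [boxIntegral, ← Int.cast_smul_eq_zsmul ℝ, integral_smul, mul_smul_comm]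

theorem boxIntegral_const (z : Dual) (a b : Space k) :
    boxIntegral (fun _ => z) a b = z * ∏ i, (b i - a i) := by
  simp [boxIntegral, Measure.real, Real.volume_Icc_pi, mul_comm]

theorem TLe.boxIntegral (hab : ∀ i, TLe θ (a i) (b i)) (hf : ContinuousOn f (TRect θ a b))
    (hg : ContinuousOn g (TRect θ a b)) (h : ∀ x ∈ TRect θ a b, TLe θ (f x) (g x)) :
    TLe θ (boxIntegral f a b) (boxIntegral g a b) := by
  have ha := left_mem_TRect hab
  have hb := right_mem_TRect hab
  rw [TRect_eq_pi] at *
  have hconv := fun i => convex_TIcc θ (a i) (b i)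
  rw [DualStokes.boxIntegral, DualStokes.boxIntegral, mul_comm, mul_comm (∏ i, _)]
  refine TLe.mul_right (.integral (integrableOn_comp_diag hconv hf ha hb)
    (integrableOn_comp_diag hconv hg ha hb) ?_)
    (TLe.prod_nonneg fun i _ => TLe_iff_sub_nonneg.1 (hab i))
  exact (ae_restrict_iff' measurableSet_Icc).2 (.of_forall fun t ht =>
    h _ (diag_mem hconv ha hb ht))

section cells

variable (P : RectPartition θ a b) (j : RectPartition.Index P)

theorem RectPartition.TLe_corner (i : Fin k) :
    TLe θ ((P i).pt (j i).castSucc) ((P i).pt (j i).succ) :=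
  Or.inl ((P i).lt (j i))

theorem RectPartition.sub_subset : RectPartition.sub P j ⊆ TRect θ a b := fun x hx i => by
  have hleft := (P i).pt_mem (j i).castSucc
  have hright := (P i).pt_mem (j i).succ
  have hxi := hx i
  rw [TIcc_eq_preimage] at *
  exact ⟨hleft.1.trans hxi.1, hxi.2.trans hright.2⟩

theorem RectPartition.sum_vol : ∑ j, RectPartition.vol P j = ∏ i, (b i - a i) := by
  simpa only [boxIntegral_const, one_mul, RectPartition.vol] using
    sum_boxIntegral (f := fun _ => 1) (fun x _ => .const 1 x) P

end cells

theorem lowerSum_TLe_boxIntegral (hf : ∀ x ∈ TRect θ a b, DualDifferentiableAt f x)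
    (P : RectPartition θ a b) : TLe θ (lowerSum f θ P) (boxIntegral f a b) := by
  have hcont := continuousOn_of_dualDifferentiableAt hf
  rw [lowerSum_eq, ← sum_boxIntegral hf P]
  refine TLe.sum fun j _ => ?_
  have hcont' := hcont.mono (RectPartition.sub_subset P j)
  rw [RectPartition.vol, ← boxIntegral_const]
  exact TLe.boxIntegral (RectPartition.TLe_corner P j) continuousOn_const hcont'
    fun x hx => lowerBound_TLe (isCompact_TRect _ _ _) hcont' hx

theorem boxIntegral_TLe_lowerSum_add (hf : ∀ x ∈ TRect θ a b, DualDifferentiableAt f x)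
    (P : RectPartition θ a b) {ρ : ℝ}
    (hρ : ∀ j, ∀ x ∈ RectPartition.sub P j, ∀ y ∈ RectPartition.sub P j, ‖f x - f y‖ ≤ ρ) :
    TLe θ (boxIntegral f a b)
      (lowerSum f θ P + (coord θ).symm (ρ, ρ) * ∏ i, (b i - a i)) := by
  have hcont := continuousOn_of_dualDifferentiableAt hf
  rw [lowerSum_eq, ← RectPartition.sum_vol P, Finset.mul_sum, ← Finset.sum_add_distrib,
    ← sum_boxIntegral hf P]
  refine TLe.sum fun j _ => ?_
  have hcorner := RectPartition.TLe_corner P j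
  have hcont' := hcont.mono (RectPartition.sub_subset P j)
  rw [← add_mul, RectPartition.vol, ← boxIntegral_const]
  refine TLe.boxIntegral hcorner hcont' continuousOn_const fun x hx => ?_
  have hlower : TLe θ (f x - (coord θ).symm (ρ, ρ)) (lowerBound θ f (RectPartition.sub P j)) := by
    refine TLe_lowerBound (isCompact_TRect _ _ _) hcont' ⟨_, left_mem_TRect hcorner⟩
      fun y hy => ?_
    have hnorm := TLe_iff_coord_le.1 (TLe_coord_symm_norm θ (f x - f y))
    rw [TLe_iff_coord_le, map_sub, sub_le_comm, ← map_sub]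
    refine hnorm.trans ?_
    rw [ContinuousLinearEquiv.apply_symm_apply, ContinuousLinearEquiv.apply_symm_apply]
    exact ⟨hρ j x hx y hy, hρ j x hx y hy⟩
  rwa [TLe_iff_coord_le, map_sub, sub_le_iff_le_add, ← map_add, ← TLe_iff_coord_le] at hlower

theorem TPartition.exists_mesh_lt {a b : Dual} (hab : TLt θ a b) {δ : ℝ} (hδ : 0 < δ) :
    ∃ P : TPartition θ a b, ∀ j : Fin P.N, ‖P.pt j.succ - P.pt j.castSucc‖ < δ := by
  obtain ⟨N, hN⟩ := exists_nat_gt (‖b - a‖ / δ)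
  have hNpos : (0 : ℝ) < N := (div_nonneg (norm_nonneg _) hδ.le).trans_lt hN
  refine ⟨{ N := N
            pt j := lineMap a b ((j : ℝ) / N)
            pt_zero := by simp
            pt_last := by simp [hNpos.ne']
            lt j := ?_ }, fun j => ?_⟩
  · rw [TLt_iff_coord_lt, coord_lineMap, coord_lineMap, lineMap_apply_module',
      lineMap_apply_module', add_lt_add_iff_right]
    refine smul_lt_smul_of_pos_right ?_ (sub_pos.2 (TLt_iff_coord_lt.1 hab))
    gcongr
    exact Fin.castSucc_lt_succ
  · rw [← dist_eq_norm, dist_lineMap_lineMap, dist_comm a b, dist_eq_norm b a]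
    simpa [Real.dist_eq, ← sub_div, abs_of_pos hNpos, div_lt_iff₀, hNpos, hδ, mul_comm,
      inv_mul_eq_div] using hN

theorem exists_rectPartition_oscillation_le (hab : ∀ i, TLt θ (a i) (b i))
    (hf : ContinuousOn f (TRect θ a b)) {ρ : ℝ} (hρ : 0 < ρ) :
    ∃ P : RectPartition θ a b, ∀ j, ∀ x ∈ RectPartition.sub P j, ∀ y ∈ RectPartition.sub P j,
      ‖f x - f y‖ ≤ ρ := by
  obtain ⟨δ, hδ, hfδ⟩ := Metric.uniformContinuousOn_iff.1
    ((isCompact_TRect θ a b).uniformContinuousOn_of_continuous hf) ρ hρ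
  choose P hP using fun i => TPartition.exists_mesh_lt (hab i) hδ
  refine ⟨P, fun j x hx y hy => ?_⟩
  rw [← dist_eq_norm]
  refine (hfδ x (RectPartition.sub_subset P j hx) y (RectPartition.sub_subset P j hy) ?_).le
  exact (dist_pi_lt_iff hδ).2 fun i =>
    (dist_eq_norm (x i) (y i)).trans_lt ((norm_sub_le_of_mem_TIcc (hx i) (hy i)).trans_lt (hP i _))

variable (hab : ∀ i, TLt θ (a i) (b i)) (hf : ∀ x ∈ TRect θ a b, DualDifferentiableAt f x)
include hab hf

theorem isLUB_lowerSum : IsLUB (range fun P : RectPartition θ a b => coord θ (lowerSum f θ P))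
    (coord θ (boxIntegral f a b)) := by
  refine ⟨forall_mem_range.2 fun P => TLe_iff_coord_le.1 (lowerSum_TLe_boxIntegral hf P),
    fun u hu => ?_⟩
  have hcont := continuousOn_of_dualDifferentiableAt hf
  set v : ℝ → ℝ × ℝ := fun ρ => u + coord θ ((coord θ).symm (ρ, ρ) * ∏ i, (b i - a i)) with hv
  have hle {ρ : ℝ} (hρ : 0 < ρ) : coord θ (boxIntegral f a b) ≤ v ρ := by
    obtain ⟨P, hP⟩ := exists_rectPartition_oscillation_le hab hcont hρ
    have h := TLe_iff_coord_le.1 (boxIntegral_TLe_lowerSum_add hf P hP)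
    rw [map_add] at h
    exact h.trans (add_le_add_left (hu (mem_range_self P)) _)
  have hv₀ : Tendsto v (𝓝[>] 0) (𝓝 u) := by
    have hcont : Continuous v := by fun_prop
    simpa [hv, ← Prod.zero_eq_mk] using (hcont.tendsto 0).mono_left nhdsWithin_le_nhds
  exact ge_of_tendsto hv₀ (eventually_mem_nhdsWithin.mono fun _ => hle)

theorem lowerIntegral_eq_boxIntegral : lowerIntegral f a b θ = boxIntegral f a b :=
  lowerIntegral_eq_of_isLUB (isLUB_lowerSum hab hf)

theorem upperIntegral_eq_boxIntegral : upperIntegral f a b θ = boxIntegral f a b := by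
  rw [upperIntegral_eq_neg_lowerIntegral_neg,
    lowerIntegral_eq_boxIntegral hab fun x hx => (hf x hx).neg, boxIntegral_neg, neg_neg]

theorem tIntegrable : TIntegrable θ f a b := by
  obtain ⟨C, hC⟩ := (isCompact_TRect θ a b).exists_bound_of_continuousOn
    (continuousOn_of_dualDifferentiableAt hf)
  refine ⟨⟨-C, C, fun x hx => ⟨?_, ?_⟩⟩, ?_⟩
  · exact abs_le.1 ((abs_Re_le_norm _).trans (hC x hx))
  · exact abs_le.1 ((abs_Ze_le_norm _).trans (hC x hx))
  · rw [lowerIntegral_eq_boxIntegral hab hf, upperIntegral_eq_boxIntegral hab hf]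

theorem tIntegral_eq_boxIntegral : tIntegral θ f a b = boxIntegral f a b :=
  upperIntegral_eq_boxIntegral hab hf

end Darboux

/-! ### The wedge product with a `1`-tensor -/

section Forms

section alternatization

variable {R M N ι : Type*} [CommRing R] [AddCommGroup M] [Module R M] [AddCommGroup N] [Module R N]
  [Fintype ι] [DecidableEq ι]

theorem alternatization_domDomCongr_perm (T : MultilinearMap R (fun _ : ι => M) N)
    (σ : Equiv.Perm ι) :
    MultilinearMap.alternatization (T.domDomCongr σ) =
      Equiv.Perm.sign σ • MultilinearMap.alternatization T := by
  ext v
  simp only [MultilinearMap.alternatization_apply, AlternatingMap.smul_apply, Finset.smul_sum]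
  rw [← Equiv.sum_comp (Equiv.mulRight σ⁻¹)]
  refine Finset.sum_congr rfl fun τ _ => ?_
  simp [smul_smul, mul_comm (Equiv.Perm.sign τ)]

theorem alternatization_domDomCongr {ι' : Type*} [Fintype ι'] [DecidableEq ι']
    (T : MultilinearMap R (fun _ : ι => M) N) (e : ι ≃ ι') :
    MultilinearMap.alternatization (T.domDomCongr e) =
      (MultilinearMap.alternatization T).domDomCongr e := by
  ext v
  simp only [AlternatingMap.domDomCongr_apply, MultilinearMap.alternatization_apply]
  rw [← Equiv.sum_comp e.permCongr]
  refine Finset.sum_congr rfl fun τ _ => ?_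
  simp [Equiv.Perm.sign_permCongr]

theorem coe_alternatizeUncurryFin_smulRight {k : ℕ} (u : M →ₗ[R] R) (η : M [⋀^Fin k]→ₗ[R] R)
    {T : MultilinearMap R (fun _ : Fin (k + 1) => M) R} (hT : ∀ v, T v = u (v 0) * η (Fin.tail v)) :
    (AlternatingMap.alternatizeUncurryFin (u.smulRight η) : MultilinearMap R _ R) =
      ∑ j : Fin (k + 1), Equiv.Perm.sign j.cycleRange • T.domDomCongr j.cycleRange.symm := by
  ext v
  simp only [AlternatingMap.coe_multilinearMap, AlternatingMap.alternatizeUncurryFin_apply,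
    sum_apply, smul_apply, MultilinearMap.domDomCongr_apply, hT, Fin.sign_cycleRange]
  refine Finset.sum_congr rfl fun j _ => ?_
  have htail : Fin.tail (fun i => v (j.cycleRange.symm i)) = j.removeNth v :=
    funext fun i => by simp [Fin.tail, Fin.removeNth]
  rw [htail, Fin.cycleRange_symm_zero]
  simp [Units.smul_def]

theorem alternatization_eq_factorial_smul {k : ℕ} [IsAddTorsionFree R] (u : M →ₗ[R] R)
    (η : M [⋀^Fin k]→ₗ[R] R) {T : MultilinearMap R (fun _ : Fin (k + 1) => M) R}
    (hT : ∀ v, T v = u (v 0) * η (Fin.tail v)) :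
    MultilinearMap.alternatization T =
      k ! • AlternatingMap.alternatizeUncurryFin (u.smulRight η) := by
  have h := congrArg MultilinearMap.alternatization (coe_alternatizeUncurryFin_smulRight u η hT)
  rw [AlternatingMap.coe_alternatization, map_sum, Fintype.card_fin] at h
  have hterm (j : Fin (k + 1)) : MultilinearMap.alternatization
      (Equiv.Perm.sign j.cycleRange • T.domDomCongr j.cycleRange.symm) =
        MultilinearMap.alternatization T := by
    rw [Units.smul_def, map_zsmul, alternatization_domDomCongr_perm, ← Units.smul_def, smul_smul,
      Equiv.Perm.sign_symm, Int.units_mul_self, one_smul]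
  simp only [hterm, Finset.sum_const, Finset.card_univ, Fintype.card_fin, Nat.factorial_succ,
    mul_smul] at h
  ext v
  exact nsmul_right_injective k.succ_ne_zero (congrArg (fun ζ => ζ v) h).symm

end alternatization

variable {n m k : ℕ}

theorem oneWedge_eq (u : Space n →ₗ[Dual] Dual) (η : Alt n k) :
    oneWedge u η = AlternatingMap.alternatizeUncurryFin (u.smulRight η) := by
  have : IsAddTorsionFree Dual := .of_module_rat _
  set T := tensor (oneForm u).toMultilinearMap η.toMultilinearMap
  have hT : MultilinearMap.alternatization (T.domDomCongr (finCongr (Nat.add_comm 1 k))) =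
      k ! • AlternatingMap.alternatizeUncurryFin (u.smulRight η) := by
    refine alternatization_eq_factorial_smul u η fun v => ?_
    simp only [T, tensor, MultilinearMap.domDomCongr_apply, LinearMap.compMultilinearMap_apply,
      MultilinearMap.domCoprod_apply, LinearMap.mul'_apply, oneForm]
    exact congrArg (_ * η ·) (funext fun i => congrArg v (Fin.ext (by simp)))
  have hscalar : ((1 + k)! : ℝ) / ((1 ! : ℝ) * k !) * (1 / (1 + k)!) * k ! = 1 := by
    rw [Nat.factorial_one, Nat.cast_one]
    field_simp
  ext1 v
  have hTv := congrArg (fun ζ : Alt n (k + 1) => ζ v) hT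
  rw [alternatization_domDomCongr] at hTv
  simp only [AlternatingMap.domDomCongr_apply, AlternatingMap.smul_apply] at hTv
  simp only [oneWedge, wedge, altOf, AlternatingMap.domDomCongr_apply, AlternatingMap.smul_apply]
  refine (congrArg (fun z => _ • (_ • z)) hTv).trans ?_
  rw [smul_smul, ← map_mul, algebraMap_smul, ← Nat.cast_smul_eq_nsmul ℝ (k !), smul_smul,
    hscalar, one_smul]

theorem oneWedge_apply (u : Space n →ₗ[Dual] Dual) (η : Alt n k) (v : Fin (k + 1) → Space n) :
    oneWedge u η v = ∑ j : Fin (k + 1), (-1 : ℤ) ^ (j : ℕ) • (u (v j) * η (j.removeNth v)) := by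
  simp [oneWedge_eq, AlternatingMap.alternatizeUncurryFin_apply]

/-! ### Differential forms -/

theorem dx_apply (I : Fin k → Fin n) (v : Fin k → Space n) :
    dx I v = (Matrix.of fun i j => v j (I i)).det := by
  induction k with
  | zero => simp [dx]
  | succ k ih =>
    rw [dx, oneWedge_apply, Matrix.det_succ_row_zero]
    refine Finset.sum_congr rfl fun j _ => ?_
    simp only [ih, LinearMap.proj_apply, Matrix.of_apply, zsmul_eq_mul, Int.cast_pow, Int.cast_neg,
      Int.cast_one, mul_assoc]
    rfl

theorem dx_single (I J : Fin k ↪o Fin n) :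
    dx I (fun j => Pi.single (J j) 1) = if I = J then 1 else 0 := by
  rw [dx_apply]
  split_ifs with h
  · subst h
    refine .trans (congrArg _ ?_) Matrix.det_one
    ext1 i j
    simp [Matrix.one_apply, Pi.single_apply]
  · obtain ⟨i, hi⟩ : ∃ i, I i ∉ range J := by
      by_contra! hc
      refine h (OrderEmbedding.range_inj.1 (eq_of_subset_of_ncard_le (range_subset_iff.2 hc) ?_))
      rw [ncard_range_of_injective I.injective, ncard_range_of_injective J.injective]
    exact Matrix.det_eq_zero_of_row_eq_zero i fun j => by
      simp [show I i ≠ J j from fun he => hi ⟨j, he.symm⟩]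

theorem alternatingMap_sum_apply {R M N ι α : Type*} [Semiring R] [AddCommMonoid M] [Module R M]
    [AddCommMonoid N] [Module R N] (s : Finset α) (f : α → M [⋀^ι]→ₗ[R] N) (v : ι → M) :
    (∑ i ∈ s, f i) v = ∑ i ∈ s, f i v :=
  map_sum (⟨⟨(· v), rfl⟩, fun _ _ => rfl⟩ : (M [⋀^ι]→ₗ[R] N) →+ N) f s

section IsDiffForm

variable {w : Form n k} {A : Set (Space n)} {p : Space n}

theorem coeff_eq_of_eq_sum {c : (Fin k ↪o Fin n) → Dual} (h : w p = ∑ I, c I • dx I)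
    (I : Fin k ↪o Fin n) : coeff w I p = c I := by
  simp [coeff, h, alternatingMap_sum_apply, dx_single]

theorem IsDiffForm.eq_sum_coeff (hw : IsDiffForm w A) (hp : p ∈ A) :
    w p = ∑ I, coeff w I p • dx I := by
  obtain ⟨f, -, hwf⟩ := hw
  simpa only [coeff_eq_of_eq_sum (hwf p hp)] using hwf p hp

theorem IsDiffForm.dualDifferentiableAt_coeff (hw : IsDiffForm w A) (hA : IsOpen A) (hp : p ∈ A)
    (I : Fin k ↪o Fin n) : DualDifferentiableAt (coeff w I) p := by
  obtain ⟨f, hf, hwf⟩ := hw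
  have hfI := dualDifferentiableAt_toSpaceOne.1
    (dualDifferentiableAt_iff_exists_hasDualDeriv.2 (hf I p hp))
  exact hfI.congr_of_eventuallyEq
    ((hA.eventually_mem hp).mono fun q hq => coeff_eq_of_eq_sum (hwf q hq) I)

theorem IsDiffForm.dualDifferentiableAt_apply (hw : IsDiffForm w A) (hA : IsOpen A) (hp : p ∈ A)
    (v : Fin k → Space n) : DualDifferentiableAt (fun q => w q v) p := by
  have hsum : DualDifferentiableAt (fun q => ∑ I, coeff w I q * dx I v) p :=
    .sum fun I _ => (hw.dualDifferentiableAt_coeff hA hp I).mul (.const _ p)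
  refine hsum.congr_of_eventuallyEq ((hA.eventually_mem hp).mono fun q hq => ?_)
  simp [hw.eq_sum_coeff hq, alternatingMap_sum_apply]

theorem IsDiffForm.d_apply (hw : IsDiffForm w A) (hA : IsOpen A) (hp : p ∈ A)
    (v : Fin (k + 1) → Space n) :
    d w p v = ∑ j : Fin (k + 1), (-1 : ℤ) ^ (j : ℕ) •
      fderiv ℝ (fun q => w q (j.removeNth v)) p (v j) := by
  have hfderiv (u : Fin k → Space n) (x : Space n) :
      fderiv ℝ (fun q => w q u) p x = ∑ I, fderiv ℝ (coeff w I) p x * dx I u := by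
    have hev : (fun q => w q u) =ᶠ[𝓝 p] fun q => ∑ I, coeff w I q * dx I u :=
      (hA.eventually_mem hp).mono fun q hq => by
        simp [hw.eq_sum_coeff hq, alternatingMap_sum_apply]
    have hdiff (I) := (hw.dualDifferentiableAt_coeff hA hp I).differentiableAt
    rw [hev.fderiv_eq, fderiv_fun_sum fun I _ => (hdiff I).mul_const _]
    simp [fderiv_mul_const (hdiff _), mul_comm]
  simp only [d, alternatingMap_sum_apply, oneWedge_apply, hfderiv, Finset.smul_sum,
    (hw.dualDifferentiableAt_coeff hA hp _).differential_apply]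
  exact Finset.sum_comm

end IsDiffForm

/-! ### Real exterior derivatives and pullbacks -/

theorem differentiableAt_clm_apply {𝕜 D E F : Type*} [NontriviallyNormedField 𝕜] [CompleteSpace 𝕜]
    [NormedAddCommGroup D] [NormedSpace 𝕜 D] [NormedAddCommGroup E] [NormedSpace 𝕜 E]
    [FiniteDimensional 𝕜 E] [NormedAddCommGroup F] [NormedSpace 𝕜 F] {f : D → E →L[𝕜] F} {x : D}
    (h : ∀ v, DifferentiableAt 𝕜 (fun y => f y v) x) : DifferentiableAt 𝕜 f x := by
  let e := ((ContinuousLinearEquiv.ofFinrankEq (Module.finrank_fin_fun 𝕜).symm).arrowCongr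
    (1 : F ≃L[𝕜] F)).trans (ContinuousLinearEquiv.piRing (Fin (Module.finrank 𝕜 E)))
  rw [← Function.id_comp f, ← e.symm_comp_self]
  exact e.symm.differentiableAt.comp x (differentiableAt_pi.2 fun i => h _)

open ContinuousAlternatingMap in
theorem extDeriv_compContinuousLinearMap_fderiv {E F G : Type*} [NormedAddCommGroup E]
    [NormedSpace ℝ E] [NormedAddCommGroup F] [NormedSpace ℝ F] [NormedAddCommGroup G]
    [NormedSpace ℝ G] {k : ℕ} {ω : F → F [⋀^Fin k]→L[ℝ] G} {f : E → F} {x : E}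
    (hω : DifferentiableAt ℝ ω (f x)) (hf : ∀ᶠ y in 𝓝 x, DifferentiableAt ℝ f y)
    (hf' : DifferentiableAt ℝ (fderiv ℝ f) x) :
    extDeriv (fun y => (ω (f y)).compContinuousLinearMap (fderiv ℝ f y)) x =
      (extDeriv ω (f x)).compContinuousLinearMap (fderiv ℝ f x) := by
  have hsymm : ∀ u v, fderiv ℝ (fderiv ℝ f) x u v = fderiv ℝ (fderiv ℝ f) x v u :=
    second_derivative_symmetric_of_eventually (hf.mono fun y hy => hy.hasFDerivAt)
      hf'.hasFDerivAt
  have hpull := ((hω.hasFDerivAt.comp x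
    hf.self_of_nhds.hasFDerivAt).continuousAlternatingMapCompContinuousLinearMap
      hf'.hasFDerivAt).fderiv
  simp only [Function.comp_apply] at hpull
  rw [extDeriv, hpull, alternatizeUncurryFin_add,
    alternatizeUncurryFin_fderivCompContinuousLinearMap_eq_zero _ _ hsymm, add_zero, extDeriv]
  ext v
  simp +unfoldPartialApp [alternatizeUncurryFin_apply, Fin.removeNth, Function.comp_def]

theorem apply_eq_sum_single {R M ι κ : Type*} [CommSemiring R] [AddCommMonoid M] [Module R M]
    [Fintype ι] [DecidableEq ι] [Fintype κ] [DecidableEq κ]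
    (f : MultilinearMap R (fun _ : ι => κ → R) M) (v : ι → κ → R) :
    f v = ∑ r : ι → κ, (∏ i, v i (r i)) • f fun i => Pi.single (r i) 1 := by
  conv_lhs => rw [funext fun i => pi_eq_sum_univ' (v i)]
  simp only [MultilinearMap.map_sum, MultilinearMap.map_smul_univ]

/-- A dual alternating tensor as a continuous real alternating map, to which the real exterior
derivative `extDeriv` applies. -/
def realForm (η : Alt n k) : Space n [⋀^Fin k]→L[ℝ] Dual :=
  .restrictScalars ℝ
    { η with
      cont := by
        rw [show η.toFun = _ from funext (apply_eq_sum_single η.toMultilinearMap)]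
        fun_prop }

theorem realForm_apply (η : Alt n k) (v : Fin k → Space n) : realForm η v = η v := rfl

section pullback

variable {w : Form n k} {A : Set (Space n)}

theorem IsDiffForm.differentiableAt_realForm (hw : IsDiffForm w A) (hA : IsOpen A) {p : Space n}
    (hp : p ∈ A) : DifferentiableAt ℝ (fun q => realForm (w q)) p := by
  let smulDx (I : Fin k ↪o Fin n) : Dual →L[ℝ] Space n [⋀^Fin k]→L[ℝ] Dual :=
    ((ContinuousLinearMap.compContinuousAlternatingMapCLM ℝ (Space n) Dual Dual (Fin k)).comp
      (ContinuousLinearMap.mul ℝ Dual)).flip (realForm (dx I))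
  have hsum : DifferentiableAt ℝ (fun q => ∑ I, smulDx I (coeff w I q)) p :=
    .fun_sum fun I _ => DifferentiableAt.comp (g := smulDx I) p (smulDx I).differentiableAt
      (hw.dualDifferentiableAt_coeff hA hp I).differentiableAt
  refine hsum.congr_of_eventuallyEq ((hA.eventually_mem hp).mono fun q hq => ?_)
  ext1 v
  simp [smulDx, realForm_apply, hw.eq_sum_coeff hq, alternatingMap_sum_apply]

theorem IsDiffForm.extDeriv_realForm (hw : IsDiffForm w A) (hA : IsOpen A) {p : Space n}
    (hp : p ∈ A) : extDeriv (fun q => realForm (w q)) p = realForm (d w p) := by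
  ext1 v
  rw [extDeriv_apply (hw.differentiableAt_realForm hA hp), realForm_apply, hw.d_apply hA hp]
  rfl

/-- Twice dual differentiability at a point: the local counterpart of `TwiceDualDiffOn`, with the
dual derivative given by `fderiv`. -/
def TwiceDualDifferentiableAt (g : Space m → Space n) (x : Space m) : Prop :=
  (∀ᶠ y in 𝓝 x, DualDifferentiableAt g y) ∧
    ∀ v, DualDifferentiableAt (fun y => fderiv ℝ g y v) x

theorem TwiceDualDiffOn.twiceDualDifferentiableAt {g : Space m → Space n} {U : Set (Space m)}
    (h : TwiceDualDiffOn g U) (hU : IsOpen U) {x : Space m} (hx : x ∈ U) :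
    TwiceDualDifferentiableAt g x := by
  obtain ⟨L, hL, hL'⟩ := h
  have hev : ∀ᶠ y in 𝓝 x, HasDualDeriv g (L y) y := (hU.eventually_mem hx).mono hL
  refine ⟨hev.mono fun y hy => dualDifferentiableAt_iff_exists_hasDualDeriv.2 ⟨_, hy⟩, fun v => ?_⟩
  refine (dualDifferentiableAt_iff_exists_hasDualDeriv.2 (hL' v x hx)).congr_of_eventuallyEq
    (hev.mono fun y hy => ?_)
  change fderiv ℝ g y v = L y v
  rw [(hasDualDeriv_iff_hasFDerivAt.1 hy).fderiv]
  rfl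

variable {g : Space m → Space n} {x : Space m}

theorem pullback_apply (hg : DualDifferentiableAt g x) (v : Fin k → Space m) :
    pullback g w x v = w (g x) fun j => fderiv ℝ g x (v j) := by
  simp only [pullback, AlternatingMap.compLinearMap_apply, hg.dualDeriv_apply]

theorem IsDiffForm.dualDifferentiableAt_pullback (hw : IsDiffForm w A) (hA : IsOpen A)
    (hg : TwiceDualDifferentiableAt g x) (hx : g x ∈ A) (v : Fin k → Space m) :
    DualDifferentiableAt (fun y => pullback g w y v) x := by
  have hsum : DualDifferentiableAt (fun y => ∑ r : Fin k → Fin n,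
      (∏ j, fderiv ℝ g y (v j) (r j)) * w (g y) fun j => Pi.single (r j) 1) x :=
    .sum fun r _ => .mul (.prod fun j _ => (hg.2 (v j)).apply (r j))
      ((hw.dualDifferentiableAt_apply hA hx _).comp hg.1.self_of_nhds)
  exact hsum.congr_of_eventuallyEq (hg.1.mono fun y hy =>
    (pullback_apply hy v).trans (apply_eq_sum_single (w (g y)).toMultilinearMap _))

theorem realForm_pullback (hg : DualDifferentiableAt g x) :
    realForm (pullback g w x) =
      (realForm (w (g x))).compContinuousLinearMap (fderiv ℝ g x) := by
  ext1 v
  exact pullback_apply hg v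

theorem IsDiffForm.pullback_d_apply (hw : IsDiffForm w A) (hA : IsOpen A)
    (hg : TwiceDualDifferentiableAt g x) (hx : g x ∈ A) (v : Fin (k + 1) → Space m) :
    pullback g (d w) x v = ∑ j : Fin (k + 1), (-1 : ℤ) ^ (j : ℕ) •
      fderiv ℝ (fun y => pullback g w y (j.removeNth v)) x (v j) := by
  have hω := hw.differentiableAt_realForm hA hx
  have hg₁ := hg.1.self_of_nhds
  have hg' : DifferentiableAt ℝ (fderiv ℝ g) x :=
    differentiableAt_clm_apply fun v => (hg.2 v).differentiableAt
  have hωg : DifferentiableAt ℝ (fun y => realForm (w (g y))) x :=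
    DifferentiableAt.comp (g := fun q => realForm (w q)) x hω hg₁.differentiableAt
  have hev : (fun y => realForm (pullback g w y)) =ᶠ[𝓝 x]
      fun y => (realForm (w (g y))).compContinuousLinearMap (fderiv ℝ g y) :=
    hg.1.mono fun y hy => realForm_pullback hy
  have hdiff : DifferentiableAt ℝ (fun y => realForm (pullback g w y)) x :=
    (hωg.continuousAlternatingMapCompContinuousLinearMap hg').congr_of_eventuallyEq hev
  calc pullback g (d w) x v
      = (extDeriv (fun q => realForm (w q)) (g x)).compContinuousLinearMap (fderiv ℝ g x) v := by
        rw [hw.extDeriv_realForm hA hx, ← realForm_pullback hg₁, realForm_apply]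
    _ = extDeriv (fun y => realForm (pullback g w y)) x v := by
        rw [hev.extDeriv_eq, extDeriv_compContinuousLinearMap_fderiv hω
          (hg.1.mono fun y hy => hy.differentiableAt) hg']
    _ = _ := extDeriv_apply hdiff v

end pullback

end Forms

/-! ### The divergence theorem over a diagonal plane -/

section divergence

variable {k : ℕ} {s : Fin (k + 1) → Set Dual} {a b : Space (k + 1)}

theorem hasFDerivAt_diag {k : ℕ} (a b : Space k) (t : Fin k → ℝ) :
    HasFDerivAt (diag a b)
      (.pi fun i => (ContinuousLinearMap.proj (R := ℝ) i).smulRight (b i - a i)) t :=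
  hasFDerivAt_pi.2 fun i => ((hasDerivAt_lineMap (a := a i) (b := b i)).hasFDerivAt.comp t
    (hasFDerivAt_apply (𝕜 := ℝ) i t)).congr_fderiv (by ext1; simp)

theorem fderiv_diag_single {k : ℕ} (a b : Space k) (t : Fin k → ℝ) (j : Fin k) :
    fderiv ℝ (diag a b) t (Pi.single j 1) = (b j - a j) • Pi.single j 1 := by
  ext1 i
  obtain rfl | h := eq_or_ne i j <;> simp [(hasFDerivAt_diag a b t).fderiv, *]

theorem boxIntegral_eq_setIntegral_mul {k : ℕ} {f : Space k → Dual} {a b : Space k}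
    (hf : IntegrableOn (fun t => f (diag a b t)) (Icc 0 1)) :
    boxIntegral f a b = ∫ t in Icc (0 : Fin k → ℝ) 1, (∏ i, (b i - a i)) * f (diag a b t) :=
  (integral_const_mul_of_integrable hf).symm

theorem diag_insertNth (a b : Space (k + 1)) (j : Fin (k + 1)) (r : ℝ) (t : Fin k → ℝ) :
    diag a b (j.insertNth (α := fun _ => ℝ) r t) =
      j.insertNth (α := fun _ => Dual) (lineMap (a j) (b j) r)
        (diag (j.removeNth a) (j.removeNth b) t) := by
  ext1 i
  refine Fin.succAboveCases j ?_ (fun l => ?_) i <;> simp [diag, Fin.removeNth]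

theorem integrableOn_comp_diag_insertNth (hs : ∀ i, Convex ℝ (s i)) {f : Space (k + 1) → Dual}
    (hf : ContinuousOn f (univ.pi s)) (ha : a ∈ univ.pi s) (hb : b ∈ univ.pi s) (j : Fin (k + 1))
    {z : Dual} (hz : z ∈ s j) :
    IntegrableOn (fun t => f (j.insertNth (α := fun _ => Dual) z
      (diag (j.removeNth a) (j.removeNth b) t))) (Icc (0 : Fin k → ℝ) 1) := by
  refine integrableOn_comp_diag (s := fun l => s (j.succAbove l))
    (f := fun x => f (j.insertNth (α := fun _ => Dual) z x)) (fun l => hs _) ?_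
    (fun l _ => ha _ trivial) (fun l _ => hb _ trivial)
  refine hf.comp (by fun_prop) fun x hx i _ => ?_
  refine Fin.succAboveCases j ?_ (fun l => ?_) i
  · simpa using hz
  · simpa using hx l trivial

theorem DualDifferentiableAt.hasFDerivAt_comp_diag {f : Space k → Dual} {a b : Space k}
    {t : Fin k → ℝ} (hf : DualDifferentiableAt f (diag a b t)) :
    HasFDerivAt (fun t => f (diag a b t)) ((fderiv ℝ f (diag a b t)).comp
      (fderiv ℝ (diag a b) t)) t :=
  hf.differentiableAt.hasFDerivAt.comp t (hasFDerivAt_diag a b t).differentiableAt.hasFDerivAt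

theorem boxIntegral_divergence (hs : ∀ i, Convex ℝ (s i)) {h : Fin (k + 1) → Space (k + 1) → Dual}
    (hh : ∀ j, ∀ x ∈ univ.pi s, DualDifferentiableAt (h j) x)
    (hdiv : ContinuousOn (fun x => ∑ j, fderiv ℝ (h j) x (Pi.single j 1)) (univ.pi s))
    (ha : a ∈ univ.pi s) (hb : b ∈ univ.pi s) :
    boxIntegral (fun x => ∑ j, fderiv ℝ (h j) x (Pi.single j 1)) a b = ∑ j,
      (boxIntegral (fun x => h j (j.insertNth (α := fun _ => Dual) (b j) x))
          (j.removeNth a) (j.removeNth b) -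
        boxIntegral (fun x => h j (j.insertNth (α := fun _ => Dual) (a j) x))
          (j.removeNth a) (j.removeNth b)) := by
  let vol (j : Fin (k + 1)) : Dual := ∏ l, (b (j.succAbove l) - a (j.succAbove l))
  have hmem {t} (ht : t ∈ Icc (0 : Fin (k + 1) → ℝ) 1) (j) := hh j _ (diag_mem hs ha hb ht)
  have hderiv (j) {t} (ht : t ∈ Icc (0 : Fin (k + 1) → ℝ) 1) :=
    (hmem ht j).hasFDerivAt_comp_diag.const_mul (vol j)
  have hsum (t) (ht : t ∈ Icc (0 : Fin (k + 1) → ℝ) 1) :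
      ∑ j, vol j * fderiv ℝ (h j) (diag a b t) (fderiv ℝ (diag a b) t (Pi.single j 1)) =
        (∏ i, (b i - a i)) * ∑ j, fderiv ℝ (h j) (diag a b t) (Pi.single j 1) := by
    rw [Finset.mul_sum]
    refine Finset.sum_congr rfl fun j _ => ?_
    rw [fderiv_diag_single, (hmem ht j).fderiv_smul, smul_eq_mul, ← mul_assoc,
      mul_comm (vol j), ← Fin.prod_univ_succAbove (fun i => b i - a i) j]
  have hint := integrableOn_comp_diag hs hdiv ha hb
  have hkey := integral_divergence_of_hasFDerivAt_off_countable' (0 : Fin (k + 1) → ℝ) 1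
    zero_le_one (fun j t => vol j * h j (diag a b t)) _ ∅ countable_empty
    (fun j t ht => (hderiv j ht).continuousAt.continuousWithinAt)
    (fun t ht j => hderiv j ⟨fun i => (ht.1 i trivial).1.le, fun i => (ht.1 i trivial).2.le⟩)
    ((integrableOn_congr_fun hsum measurableSet_Icc).2 (hint.const_mul _))
  have hface (j) (r : ℝ) {z : Dual} (hr : lineMap (a j) (b j) r = z) (hz : z ∈ s j) :
      ∫ t in Icc (0 : Fin k → ℝ) 1, vol j * h j (diag a b (j.insertNth r t)) =
        boxIntegral (fun x => h j (j.insertNth (α := fun _ => Dual) z x))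
          (j.removeNth a) (j.removeNth b) := by
    simp only [diag_insertNth, hr]
    exact (boxIntegral_eq_setIntegral_mul
      (f := fun x => h j (j.insertNth (α := fun _ => Dual) z x))
      (integrableOn_comp_diag_insertNth hs (continuousOn_of_dualDifferentiableAt (hh j))
        ha hb j hz)).symm
  rw [boxIntegral_eq_setIntegral_mul hint, ← setIntegral_congr_fun measurableSet_Icc hsum]
  exact hkey.trans (Finset.sum_congr rfl fun j _ => congrArg₂ _
    (hface j 1 (lineMap_apply_one _ _) (hb j trivial))
    (hface j 0 (lineMap_apply_zero _ _) (ha j trivial)))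

end divergence

theorem ext_of_apply_single_of_isUnit {R E ι : Type*} [CommRing R] [AddCommGroup E] [Module R E]
    [Finite ι] [DecidableEq ι] {L M : (ι → R) →ₗ[R] E} {u : ι → R} (hu : ∀ i, IsUnit (u i))
    (h : ∀ i, L (Pi.single i (u i)) = M (Pi.single i (u i))) : L = M := by
  refine LinearMap.pi_ext fun i z => ?_
  have hz : (Pi.single i z : ι → R) = (z * ((hu i).unit⁻¹ : Rˣ)) • Pi.single i (u i) := by
    simp [← Pi.single_smul, mul_assoc]
  rw [hz, map_smul, map_smul, h]

-- The box may have empty interior (the cubes with `r = 0` lie in `ℝⁿ`), but since the widths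
-- `b i - a i` are units, its directions generate `Space n` over the dual numbers.
theorem DualDifferentiableAt.fderiv_eq_of_eqOn {n m : ℕ} {s : Fin n → Set Dual}
    {f g : Space n → Space m} {a b p : Space n} (hf : DualDifferentiableAt f p)
    (hg : DualDifferentiableAt g p) (hs : ∀ i, Convex ℝ (s i)) (hfg : EqOn f g (univ.pi s))
    (ha : a ∈ univ.pi s) (hb : b ∈ univ.pi s) (hp : p ∈ univ.pi s)
    (hab : ∀ i, IsUnit (b i - a i)) : fderiv ℝ f p = fderiv ℝ g p := by
  obtain ⟨L, hL⟩ := hf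
  obtain ⟨M, hM⟩ := hg
  have hsub {q} (hq : q ∈ univ.pi s) : L (q - p) = M (q - p) :=
    hL.hasFDerivWithinAt.unique_on (hM.hasFDerivWithinAt.congr hfg (hfg hp))
      (mem_tangentConeAt_of_segment_subset
        ((convex_pi fun i _ => hs i).segment_subset hp hq))
  have hsingle (i) : L (Pi.single i (b i - a i)) = M (Pi.single i (b i - a i)) := by
    have hmem {z} (hz : z ∈ s i) : Function.update p i z ∈ univ.pi s :=
      (update_mem_pi_iff_of_mem hp).2 fun _ => hz
    have hdiff : (Pi.single i (b i - a i) : Space n) =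
        (Function.update p i (b i) - p) - (Function.update p i (a i) - p) := by
      ext1 l
      obtain rfl | h := eq_or_ne l i <;> simp [*]
    rw [hdiff, map_sub L, map_sub M, hsub (hmem (hb i trivial)), hsub (hmem (ha i trivial))]
  have hLM : L = M :=
    ContinuousLinearMap.coe_injective (ext_of_apply_single_of_isUnit hab hsingle)
  rw [hL.fderiv, hM.fderiv, hLM]

/-! ### Stokes' theorem -/

section Stokes

variable {θ : Kind} {r : ℝ≥0} {n k : ℕ} {A : Set (Space n)} {w : Form n k}

theorem TLt_zero_bPt (θ : Kind) (r : ℝ≥0) : TLt θ 0 (bPt θ r) := by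
  cases θ <;> left <;> simp [bPt, mkDual, Re, Ze, Kind.sgn]

theorem isUnit_bPt (θ : Kind) (r : ℝ≥0) : IsUnit (bPt θ r) :=
  TrivSqZeroExt.isUnit_iff_isUnit_fst.2 (by simp [bPt, mkDual])

theorem cube_eq_pi (θ : Kind) (r : ℝ≥0) (k : ℕ) :
    cube θ r k = univ.pi fun _ => TIcc θ 0 (bPt θ r) :=
  TRect_eq_pi θ _ _

theorem zero_mem_cube (θ : Kind) (r : ℝ≥0) (k : ℕ) : (fun _ => 0) ∈ cube θ r k :=
  left_mem_TRect fun _ => Or.inl (TLt_zero_bPt θ r)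

theorem bPt_mem_cube (θ : Kind) (r : ℝ≥0) (k : ℕ) : (fun _ => bPt θ r) ∈ cube θ r k :=
  right_mem_TRect fun _ => Or.inl (TLt_zero_bPt θ r)

theorem boxIntegral_cube_congr {f g : Space k → Dual} (h : EqOn f g (cube θ r k)) :
    boxIntegral f (fun _ => 0) (fun _ => bPt θ r) =
      boxIntegral g (fun _ => 0) (fun _ => bPt θ r) := by
  rw [cube_eq_pi] at h
  exact congrArg (_ * ·) (setIntegral_congr_fun measurableSet_Icc fun t ht =>
    h (diag_mem (fun _ => convex_TIcc θ _ _)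
      (cube_eq_pi θ r k ▸ zero_mem_cube θ r k) (cube_eq_pi θ r k ▸ bPt_mem_cube θ r k) ht))

namespace SingularCube

theorem ext_eq (c : SingularCube θ r k A) (x : cube θ r k) : c.ext x = c.toFun x :=
  c.exists_ext.choose_spec.1 x

theorem ext_mem (c : SingularCube θ r k A) {x : Space k} (hx : x ∈ cube θ r k) : c.ext x ∈ A :=
  c.ext_eq ⟨x, hx⟩ ▸ c.mem _

theorem twiceDualDifferentiableAt_ext (c : SingularCube θ r k A) {x : Space k}
    (hx : x ∈ cube θ r k) : TwiceDualDifferentiableAt c.ext x := by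
  obtain ⟨U, hU, hcU, hext⟩ := c.exists_ext.choose_spec.2
  exact TwiceDualDiffOn.twiceDualDifferentiableAt hext hU (hcU hx)

theorem dualDifferentiableAt_pullback_ext (c : SingularCube θ r k A) (hA : IsOpen A)
    {l : ℕ} {w : Form n l} (hw : IsDiffForm w A) {x : Space k} (hx : x ∈ cube θ r k)
    (v : Fin l → Space k) : DualDifferentiableAt (fun y => pullback c.ext w y v) x :=
  hw.dualDifferentiableAt_pullback hA (c.twiceDualDifferentiableAt_ext hx) (c.ext_mem hx) v

theorem cubeIntegrable (c : SingularCube θ r k A) (hA : IsOpen A) (hw : IsDiffForm w A) :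
    CubeIntegrable w c := by
  cases k with
  | zero => trivial
  | succ k => exact tIntegrable (fun _ => TLt_zero_bPt θ r) fun x hx =>
      c.dualDifferentiableAt_pullback_ext hA hw hx _

theorem cubeIntegral_eq_boxIntegral (c : SingularCube θ r k A) (hA : IsOpen A)
    (hw : IsDiffForm w A) :
    cubeIntegral w c =
      boxIntegral (topCoeff (pullback c.ext w)) (fun _ => 0) (fun _ => bPt θ r) := by
  cases k with
  | zero =>
    have htop : EqOn (topCoeff (pullback c.ext w)) (fun _ => cubeIntegral w c) (cube θ r 0) := by
      intro x hx
      obtain rfl : x = 0 := Subsingleton.elim _ _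
      exact congrArg₂ (fun p v => w p v) (c.ext_eq ⟨_, hx⟩) (Subsingleton.elim _ _)
    rw [boxIntegral_cube_congr htop, boxIntegral_const, Finset.prod_of_isEmpty, mul_one]
  | succ k => exact tIntegral_eq_boxIntegral (fun _ => TLt_zero_bPt θ r) fun x hx =>
      c.dualDifferentiableAt_pullback_ext hA hw hx _

theorem fderiv_ext_face (c : SingularCube θ r (k + 1) A) (j : Fin (k + 1)) (α : Fin 2)
    {x : Space k} (hx : x ∈ cube θ r k) (v : Space k) :
    fderiv ℝ (c.face j α).ext x v = fderiv ℝ c.ext (faceMap θ r j α x) (faceLin j v) := by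
  have hc := (c.twiceDualDifferentiableAt_ext (faceMap_mem θ r j α hx)).1.self_of_nhds
  obtain ⟨L, hL⟩ := dualDifferentiableAt_iff_exists_hasDualDeriv.1 hc
  have heq : EqOn (c.face j α).ext (fun y => c.ext (faceMap θ r j α y)) (cube θ r k) :=
    fun y hy => ((c.face j α).ext_eq ⟨y, hy⟩).trans (c.ext_eq ⟨_, faceMap_mem θ r j α hy⟩).symm
  have hzero := zero_mem_cube θ r k
  have hbPt := bPt_mem_cube θ r k
  rw [cube_eq_pi] at heq hx hzero hbPt
  rw [((c.face j α).twiceDualDifferentiableAt_ext (cube_eq_pi θ r k ▸ hx)).1.self_of_nhds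
      |>.fderiv_eq_of_eqOn (dualDifferentiableAt_iff_exists_hasDualDeriv.2 ⟨_, hL.comp_faceMap⟩)
        (fun _ => convex_TIcc θ _ _) heq hzero hbPt hx
        fun _ => by simpa only [sub_zero] using isUnit_bPt θ r,
    (hasDualDeriv_iff_hasFDerivAt.1 hL.comp_faceMap).fderiv,
    (hasDualDeriv_iff_hasFDerivAt.1 hL).fderiv]
  rfl

theorem topCoeff_pullback_ext_face (c : SingularCube θ r (k + 1) A) (w : Form n k)
    (j : Fin (k + 1)) (α : Fin 2) {x : Space k} (hx : x ∈ cube θ r k) :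
    topCoeff (pullback (c.face j α).ext w) x =
      pullback c.ext w (faceMap θ r j α x) fun l => Pi.single (j.succAbove l) 1 := by
  have hx' := faceMap_mem θ r j α hx
  have hlin (l : Fin k) : faceLin j (Pi.single l 1) = Pi.single (j.succAbove l) 1 := by
    ext1 i
    refine Fin.succAboveCases j ?_ (fun i => ?_) i <;> simp [faceLin, Pi.single_apply]
  refine (pullback_apply
    ((c.face j α).twiceDualDifferentiableAt_ext hx).1.self_of_nhds _).trans ?_
  rw [pullback_apply (c.twiceDualDifferentiableAt_ext hx').1.self_of_nhds,
    (c.face j α).ext_eq ⟨x, hx⟩, c.ext_eq ⟨_, hx'⟩]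
  refine congrArg _ (funext fun l => ?_)
  exact (c.fderiv_ext_face j α hx _).trans (congrArg _ (hlin l))

/-- The vector field dual to the pullback `c^* w` of a form of codimension one: its `j`-th component
is `(-1)^j` times the coefficient of `c^* w` without `dx^j` (with `j` counted from `0`), so that its
divergence is the coefficient of `c^* dw`. -/
def dualField (c : SingularCube θ r (k + 1) A) (w : Form n k) (j : Fin (k + 1)) :
    Space (k + 1) → Dual :=
  fun x => (-1 : ℤ) ^ (j : ℕ) • pullback c.ext w x fun l => Pi.single (j.succAbove l) 1

variable (c : SingularCube θ r (k + 1) A) (hA : IsOpen A) (hw : IsDiffForm w A)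
include hA hw

theorem dualDifferentiableAt_dualField {x : Space (k + 1)} (hx : x ∈ cube θ r (k + 1))
    (j : Fin (k + 1)) : DualDifferentiableAt (c.dualField w j) x :=
  (c.dualDifferentiableAt_pullback_ext hA hw hx _).const_zsmul _

theorem topCoeff_pullback_ext_d {x : Space (k + 1)} (hx : x ∈ cube θ r (k + 1)) :
    topCoeff (pullback c.ext (d w)) x =
      ∑ j, fderiv ℝ (c.dualField w j) x (Pi.single j 1) := by
  refine (hw.pullback_d_apply hA (c.twiceDualDifferentiableAt_ext hx) (c.ext_mem hx) _).trans
    (Finset.sum_congr rfl fun j _ => ?_)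
  have hpull := (c.dualDifferentiableAt_pullback_ext hA hw hx
    fun l => Pi.single (j.succAbove l) 1).differentiableAt
  exact (DFunLike.congr_fun (hpull.hasFDerivAt.const_smul ((-1 : ℤ) ^ (j : ℕ))).fderiv _).symm

theorem boxIntegral_dualField_face (j : Fin (k + 1)) (α : Fin 2) :
    boxIntegral (fun x => c.dualField w j (faceMap θ r j α x)) (fun _ => 0) (fun _ => bPt θ r) =
      (-1 : ℤ) ^ (j : ℕ) • cubeIntegral w (c.face j α) := by
  rw [(c.face j α).cubeIntegral_eq_boxIntegral hA hw, ← boxIntegral_zsmul]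
  exact boxIntegral_cube_congr fun x hx =>
    congrArg (_ • ·) (c.topCoeff_pullback_ext_face w j α hx).symm

theorem cubeIntegral_d (hdw : IsDiffForm (d w) A) :
    cubeIntegral (d w) c = ∑ j : Fin (k + 1), (-1 : ℤ) ^ (j : ℕ) •
      (cubeIntegral w (c.face j 1) - cubeIntegral w (c.face j 0)) := by
  have hdiv : EqOn (topCoeff (pullback c.ext (d w)))
      (fun x => ∑ j, fderiv ℝ (c.dualField w j) x (Pi.single j 1)) (cube θ r (k + 1)) :=
    fun x hx => c.topCoeff_pullback_ext_d hA hw hx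
  have hcont : ContinuousOn (topCoeff (pullback c.ext (d w))) (cube θ r (k + 1)) :=
    continuousOn_of_dualDifferentiableAt fun x hx =>
      c.dualDifferentiableAt_pullback_ext hA hdw hx _
  have hfield (j) (x) (hx : x ∈ cube θ r (k + 1)) := c.dualDifferentiableAt_dualField hA hw hx j
  have hzero := zero_mem_cube θ r (k + 1)
  have hbPt := bPt_mem_cube θ r (k + 1)
  rw [c.cubeIntegral_eq_boxIntegral hA hdw, boxIntegral_cube_congr hdiv]
  replace hcont := hcont.congr hdiv.symm
  rw [cube_eq_pi] at hfield hcont hzero hbPt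
  rw [boxIntegral_divergence (fun _ => convex_TIcc θ _ _) hfield hcont hzero hbPt]
  refine Finset.sum_congr rfl fun j _ => ?_
  rw [smul_sub, ← c.boxIntegral_dualField_face hA hw, ← c.boxIntegral_dualField_face hA hw]
  simp only [faceMap, facePt, Fin.val_zero, Fin.val_one, Nat.cast_zero, Nat.cast_one, zero_mul,
    one_mul]
  rfl

end SingularCube

/-- Integration of `w` over chains as a linear map. -/
def chainIntegralHom (θ : Kind) (r : ℝ≥0) (A : Set (Space n)) (w : Form n k) :
    Chain θ r k A →ₗ[ℤ] Dual :=
  Finsupp.linearCombination ℤ fun s => cubeIntegral w s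

theorem chainIntegralHom_apply (w : Form n k) (c : Chain θ r k A) :
    chainIntegralHom θ r A w c = chainIntegral w c := rfl

theorem chainIntegral_cubeBoundary (w : Form n k) (c : SingularCube θ r (k + 1) A) :
    chainIntegral w c.boundary = ∑ j : Fin (k + 1), (-1 : ℤ) ^ (j : ℕ) •
      (cubeIntegral w (c.face j 1) - cubeIntegral w (c.face j 0)) := by
  rw [← chainIntegralHom_apply, SingularCube.boundary, map_sum]
  refine Finset.sum_congr rfl fun j _ => ?_
  rw [Fin.sum_univ_two, map_add]
  simp only [chainIntegralHom, Finsupp.linearCombination_single, Fin.val_zero, Fin.val_one,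
    pow_succ, add_zero, mul_neg, mul_one, neg_neg, neg_smul, smul_sub]
  abel

end Stokes

end DualStokes

end

theorem proposition6p1 (θ : DualStokes.Kind) (r : NNReal) (n k : ℕ)
    (A : Set (DualStokes.Space n)) (hA : IsOpen A)
    (w : DualStokes.Form n k)
    (hw : DualStokes.IsDiffForm w A)
    (hdw : DualStokes.IsDiffForm (DualStokes.d w) A)
    (c : DualStokes.Chain θ r (k + 1) A) :
    DualStokes.ChainIntegrable (DualStokes.d w) c ∧
      DualStokes.ChainIntegrable w c.boundary ∧
      DualStokes.chainIntegral (DualStokes.d w) c = DualStokes.chainIntegral w c.boundary := by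
  refine ⟨fun s _ => s.cubeIntegrable hA hdw, fun s _ => s.cubeIntegrable hA hw, ?_⟩
  rw [← DualStokes.chainIntegralHom_apply w, DualStokes.Chain.boundary, Finsupp.sum, map_sum,
    DualStokes.chainIntegral, Finsupp.sum]
  refine Finset.sum_congr rfl fun s _ => ?_
  rw [map_zsmul, DualStokes.chainIntegralHom_apply, DualStokes.chainIntegral_cubeBoundary,
    s.cubeIntegral_d hA hw hdw]
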